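/- Let $d\in\mathbb{N}$ and $0<\alpha\le 1$. For a normed space $F$, let $\mathcal{C}^{1+\alpha}(\mathbb{R}^d;F)$ be the normed space of all $\mathcal{C}^1$ functions $f:\mathbb{R}^d\to F$ with finite norm $$\|f\|_{\mathcal{C}^{1+\alpha}}=\sup_{x}|f(x)|+\sup_{x}|\nabla f(x)|+\sup_{x\neq y}\frac{|\nabla f(x)-\nabla f(y)|}{|x-y|^{\alpha}},$$ and write $\mathcal{C}^{1+\alpha}(\mathbb{R}^d)$ for $F=\mathbb{R}$. Let $\mathcal{M}(\mathbb{R}^d)$ be the space of bounded signed Radon measures, embedded in the dual space $(\mathcal{C}^{1+\alpha}(\mathbb{R}^d))^*$ by $\mu\mapsto\left(f\mapsto\int f\,d\mu\right)$, and let $Z$ be the closure of $\mathcal{M}(\mathbb{R}^d)$ in $(\mathcal{C}^{1+\alpha}(\mathbb{R}^d))^*$, a Banach space with the dual norm. Let $t\mapsto b(t,\cdot)$ and $t\mapsto b_1(t,\cdot)$ be continuous maps from $[0,\infty)$ to $\mathcal{C}^{1+\alpha}(\mathbb{R}^d;\mathbb{R}^d)$, let $w\in\mathcal{C}^{1+\alpha}([0,\infty)\times\mathbb{R}^d)$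 (that is, $w$ is real-valued, of class $\mathcal{C}^1$ on $[0,\infty)\times\mathbb{R}^d$ and bounded, with bounded and $\alpha$-Hölder continuous derivative), and let $\mu_0$ be a probability measure on $\mathbb{R}^d$. For $h\in[-\tfrac12,\tfrac12]$ put $b^h=b+h\,b_1$. A weak solution of $$\partial_t\mu_t^h+\mathrm{div}_x(b^h\mu_t^h)=w\,\mu_t^h,\qquad \mu^h_{t=0}=\mu_0,$$ is a narrowly continuous curve $[0,\infty)\ni t\mapsto\mu_t^h$ of finite positive Borel measures on $\mathbb{R}^d$ such that for all $\varphi\in\mathcal{C}^1_c([0,\infty)\times\mathbb{R}^d)$ $$\int_0^\infty\!\!\int_{\mathbb{R}^d}\left(\partial_t\varphi+b^h\cdot\nabla_x\varphi\right)d\mu_t^h\,dt+\int_{\mathbb{R}^d}\varphi(0,\cdot)\,d\mu_0=-\int_0^\infty\!\!\int_{\mathbb{R}^d}w\,\varphi\,d\mu_t^h\,dt .$$ Then for every $h\in[-\tfrac12,\tfrac12]$ there is exactly one weak solution $\mu^h$, and for every $t\ge 0$ the map $$[-\tfrac12,\tfrac12]\ni h\mapsto\mu_t^h\in Z$$ is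 differentiable with respect to the norm of $Z$ (one-sidedly at the end points); in particular $\partial_h\mu_t^h\in Z$. -/

import Mathlib

open Set MeasureTheory
open scoped NNReal

noncomputable section

namespace MeasureTransport

/-- The linear space underlying `C^{1+α}(E; F)`: functions `f : E → F` of class `C¹` such that `f` and its derivative
are bounded and the derivative is `α`-Hölder continuous on `E`. -/
def holderC1Submodule (α : ℝ≥0) (E F : Type*) [NormedAddCommGroup E] [NormedSpace ℝ E]
    [NormedAddCommGroup F] [NormedSpace ℝ F] : Submodule ℝ (E → F) where
  carrier := {f | ContDiff ℝ 1 f ∧ (∃ C : ℝ, ∀ x, ‖f x‖ ≤ C) ∧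
    (∃ C : ℝ, ∀ x, ‖fderiv ℝ f x‖ ≤ C) ∧ MemHolder α (fderiv ℝ f)}
  add_mem' := by
    rintro f g ⟨hf, ⟨C₁, h₁⟩, ⟨C₂, h₂⟩, hf'⟩ ⟨hg, ⟨D₁, k₁⟩, ⟨D₂, k₂⟩, hg'⟩
    have e : fderiv ℝ (f + g) = fderiv ℝ f + fderiv ℝ g := by
      funext x
      exact fderiv_add (hf.differentiable one_ne_zero x) (hg.differentiable one_ne_zero x)
    refine ⟨hf.add hg, ⟨C₁ + D₁, fun x => ?_⟩, ⟨C₂ + D₂, fun x => ?_⟩, ?_⟩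
    · exact (norm_add_le _ _).trans (add_le_add (h₁ x) (k₁ x))
    · rw [e]
      exact (norm_add_le _ _).trans (add_le_add (h₂ x) (k₂ x))
    · rw [e]
      exact hf'.add hg'
  zero_mem' := by
    have e : fderiv ℝ (0 : E → F) = 0 := by
      funext x
      simp
    refine ⟨contDiff_const, ⟨0, fun x => by simp⟩, ⟨0, fun x => by simp [e]⟩, ?_⟩
    rw [e]
    exact memHolder_zero
  smul_mem' := by
    rintro c f ⟨hf, ⟨C₁, h₁⟩, ⟨C₂, h₂⟩, hf'⟩
    have e : fderiv ℝ (c • f) = c • fderiv ℝ f := by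
      funext x
      exact fderiv_const_smul (hf.differentiable one_ne_zero x) c
    refine ⟨hf.const_smul c, ⟨‖c‖ * C₁, fun x => ?_⟩, ⟨‖c‖ * C₂, fun x => ?_⟩, ?_⟩
    · rw [Pi.smul_apply, norm_smul]
      exact mul_le_mul_of_nonneg_left (h₁ x) (norm_nonneg _)
    · rw [e, Pi.smul_apply, norm_smul]
      exact mul_le_mul_of_nonneg_left (h₂ x) (norm_nonneg _)
    · rw [e]
      exact hf'.smul

/-- The Hölder space `C^{1+α}(E; F)`. It is a type of its own, so that its topology is the one of the
Hölder norm below, and not the topology of pointwise convergence of a subspace of `E → F`. -/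
def HolderC1 (α : ℝ≥0) (E F : Type*) [NormedAddCommGroup E] [NormedSpace ℝ E]
    [NormedAddCommGroup F] [NormedSpace ℝ F] : Type _ := holderC1Submodule α E F

namespace HolderC1

variable {α : ℝ≥0} {E F : Type*} [NormedAddCommGroup E] [NormedSpace ℝ E]
  [NormedAddCommGroup F] [NormedSpace ℝ F]

instance : AddCommGroup (HolderC1 α E F) :=
  inferInstanceAs (AddCommGroup (holderC1Submodule α E F))

instance : Module ℝ (HolderC1 α E F) := inferInstanceAs (Module ℝ (holderC1Submodule α E F))

instance : FunLike (HolderC1 α E F) E F := ⟨fun f => f.1, Subtype.val_injective⟩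

/-- The Hölder norm `sup |f| + sup |Df| + sup_{x ≠ y} |Df(x) - Df(y)| / |x - y|^α`. -/
instance : Norm (HolderC1 α E F) :=
  ⟨fun f => (⨆ x, ‖f x‖) + (⨆ x, ‖fderiv ℝ f x‖) + nnHolderNorm α (fderiv ℝ f)⟩

theorem norm_def (f : HolderC1 α E F) :
    ‖f‖ = (⨆ x, ‖f x‖) + (⨆ x, ‖fderiv ℝ f x‖) + nnHolderNorm α (fderiv ℝ f) := rfl

theorem contDiff (f : HolderC1 α E F) : ContDiff ℝ 1 f := f.2.1

theorem bddAbove (f : HolderC1 α E F) : BddAbove (range fun x => ‖f x‖) := by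
  obtain ⟨C, hC⟩ := f.2.2.1
  exact ⟨C, by rintro _ ⟨x, rfl⟩; exact hC x⟩

theorem bddAbove_fderiv (f : HolderC1 α E F) : BddAbove (range fun x => ‖fderiv ℝ f x‖) := by
  obtain ⟨C, hC⟩ := f.2.2.2.1
  exact ⟨C, by rintro _ ⟨x, rfl⟩; exact hC x⟩

theorem memHolder (f : HolderC1 α E F) : MemHolder α (fderiv ℝ f) := f.2.2.2.2

theorem fderiv_coe_add (f g : HolderC1 α E F) :
    fderiv ℝ (f + g : HolderC1 α E F) = fderiv ℝ f + fderiv ℝ g := by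
  funext x
  exact fderiv_add (f.contDiff.differentiable one_ne_zero x)
    (g.contDiff.differentiable one_ne_zero x)

theorem fderiv_coe_smul (c : ℝ) (f : HolderC1 α E F) :
    fderiv ℝ (c • f : HolderC1 α E F) = c • fderiv ℝ f := by
  funext x
  exact fderiv_const_smul (f.contDiff.differentiable one_ne_zero x) c

theorem norm_apply_le (f : HolderC1 α E F) (x : E) : ‖f x‖ ≤ ‖f‖ := by
  have h₁ : ‖f x‖ ≤ ⨆ x, ‖f x‖ := le_ciSup f.bddAbove x
  have h₂ : 0 ≤ ⨆ x, ‖fderiv ℝ f x‖ := Real.iSup_nonneg fun _ => norm_nonneg _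
  have h₃ : (0 : ℝ) ≤ nnHolderNorm α (fderiv ℝ f) := NNReal.coe_nonneg _
  rw [norm_def]
  linarith

theorem core : NormedSpace.Core ℝ (HolderC1 α E F) where
  norm_nonneg f := (norm_nonneg _).trans (f.norm_apply_le 0)
  norm_smul c f := by
    have h₁ : (⨆ x, ‖(c • f : HolderC1 α E F) x‖) = ‖c‖ * ⨆ x, ‖f x‖ := by
      rw [Real.mul_iSup_of_nonneg (norm_nonneg c)]
      exact congrArg _ (funext fun x => norm_smul c (f x))
    have h₂ : (⨆ x, ‖(c • fderiv ℝ f) x‖) = ‖c‖ * ⨆ x, ‖fderiv ℝ f x‖ := by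
      rw [Real.mul_iSup_of_nonneg (norm_nonneg c)]
      exact congrArg _ (funext fun x => norm_smul c (fderiv ℝ f x))
    rw [norm_def, norm_def, fderiv_coe_smul, h₁, h₂, f.memHolder.nnHolderNorm_smul]
    push_cast
    ring
  norm_triangle f g := by
    have h₁ : (⨆ x, ‖(f + g : HolderC1 α E F) x‖) ≤ (⨆ x, ‖f x‖) + ⨆ x, ‖g x‖ :=
      ciSup_le fun x => (norm_add_le (f x) (g x)).trans
        (add_le_add (le_ciSup f.bddAbove x) (le_ciSup g.bddAbove x))
    have h₂ : (⨆ x, ‖(fderiv ℝ f + fderiv ℝ g) x‖)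
        ≤ (⨆ x, ‖fderiv ℝ f x‖) + ⨆ x, ‖fderiv ℝ g x‖ :=
      ciSup_le fun x => (norm_add_le (fderiv ℝ f x) (fderiv ℝ g x)).trans
        (add_le_add (le_ciSup f.bddAbove_fderiv x) (le_ciSup g.bddAbove_fderiv x))
    have h₃ : (nnHolderNorm α (fderiv ℝ f + fderiv ℝ g) : ℝ)
        ≤ nnHolderNorm α (fderiv ℝ f) + nnHolderNorm α (fderiv ℝ g) := by
      exact_mod_cast f.memHolder.nnHolderNorm_add_le g.memHolder
    rw [norm_def, norm_def, norm_def, fderiv_coe_add]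
    linarith
  norm_eq_zero_iff f := by
    constructor
    · intro h
      refine Subtype.ext (funext fun x => ?_)
      have := f.norm_apply_le x
      rw [h] at this
      exact norm_le_zero_iff.1 this
    · rintro rfl
      have e : fderiv ℝ (0 : E → F) = 0 := by
        funext x
        simp
      rw [norm_def]
      change (⨆ x, ‖(0 : E → F) x‖) + (⨆ x, ‖fderiv ℝ (0 : E → F) x‖)
        + nnHolderNorm α (fderiv ℝ (0 : E → F)) = 0
      rw [e]
      simp

instance : NormedAddCommGroup (HolderC1 α E F) := NormedAddCommGroup.ofCore core

instance : NormedSpace ℝ (HolderC1 α E F) := NormedSpace.ofCore core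

end HolderC1

/-- `f` belongs to `C^{1+α}(S; F)`: on `S` it is of class `C¹`, bounded, with bounded and
`α`-Hölder continuous derivative (`S` is meant to be a set of unique differentiability, such as
a closed half-space). -/
def MemHolderC1On (α : ℝ≥0) {E F : Type*} [NormedAddCommGroup E] [NormedSpace ℝ E]
    [NormedAddCommGroup F] [NormedSpace ℝ F] (f : E → F) (S : Set E) : Prop :=
  ContDiffOn ℝ 1 f S ∧ (∃ C : ℝ, ∀ x ∈ S, ‖f x‖ ≤ C) ∧
    (∃ C : ℝ, ∀ x ∈ S, ‖fderivWithin ℝ f S x‖ ≤ C) ∧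
    ∃ C : ℝ≥0, HolderOnWith C α (fderivWithin ℝ f S) S

section Space

variable (α : ℝ≥0) {d : ℕ}

/-- A finite positive Borel measure as the functional `f ↦ ∫ f dμ` on `C^{1+α}(ℝ^d)`. -/
def measureFunctional (μ : FiniteMeasure (EuclideanSpace ℝ (Fin d))) :
    StrongDual ℝ (HolderC1 α (EuclideanSpace ℝ (Fin d)) ℝ) :=
  have int (f : HolderC1 α (EuclideanSpace ℝ (Fin d)) ℝ) :
      Integrable (fun x => f x) (μ : Measure (EuclideanSpace ℝ (Fin d))) :=
    Integrable.of_bound f.contDiff.continuous.aestronglyMeasurable ‖f‖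
      (Filter.Eventually.of_forall f.norm_apply_le)
  LinearMap.mkContinuous
    { toFun := fun f => ∫ x, f x ∂(μ : Measure (EuclideanSpace ℝ (Fin d)))
      map_add' := fun f g => integral_add (int f) (int g)
      map_smul' := fun c f => integral_const_mul c (fun x => f x) }
    ((μ : Measure (EuclideanSpace ℝ (Fin d))).real univ)
    (fun f => by
      have h := norm_integral_le_of_norm_le_const
        (μ := (μ : Measure (EuclideanSpace ℝ (Fin d))))
        (Filter.Eventually.of_forall f.norm_apply_le)
      rw [mul_comm]
      exact h)

theorem measureFunctional_apply (μ : FiniteMeasure (EuclideanSpace ℝ (Fin d)))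
    (f : HolderC1 α (EuclideanSpace ℝ (Fin d)) ℝ) :
    measureFunctional α μ f = ∫ x, f x ∂(μ : Measure (EuclideanSpace ℝ (Fin d))) := rfl

theorem measureFunctional_add (μ ν : FiniteMeasure (EuclideanSpace ℝ (Fin d))) :
    measureFunctional α (μ + ν) = measureFunctional α μ + measureFunctional α ν := by
  ext f
  have int (ρ : FiniteMeasure (EuclideanSpace ℝ (Fin d))) :
      Integrable (fun x => f x) (ρ : Measure (EuclideanSpace ℝ (Fin d))) :=
    Integrable.of_bound f.contDiff.continuous.aestronglyMeasurable ‖f‖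
      (Filter.Eventually.of_forall f.norm_apply_le)
  simp only [measureFunctional_apply, _root_.add_apply, FiniteMeasure.toMeasure_add]
  exact integral_add_measure (int μ) (int ν)

theorem measureFunctional_smul (c : ℝ≥0) (μ : FiniteMeasure (EuclideanSpace ℝ (Fin d))) :
    measureFunctional α (c • μ) = (c : ℝ) • measureFunctional α μ := by
  ext f
  simp only [measureFunctional_apply, _root_.smul_apply, FiniteMeasure.toMeasure_smul]
  exact integral_smul_nnreal_measure _ c

variable (d) in
/-- The space `M(ℝ^d)` of bounded signed Radon measures, as a subspace of the dual of
`C^{1+α}(ℝ^d)`. By the Jordan decomposition the bounded signed Radon measures are the differences of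
two finite positive Borel measures. -/
def measureSubspace : Submodule ℝ (StrongDual ℝ (HolderC1 α (EuclideanSpace ℝ (Fin d)) ℝ)) where
  carrier := {L | ∃ μ ν : FiniteMeasure (EuclideanSpace ℝ (Fin d)),
    L = measureFunctional α μ - measureFunctional α ν}
  add_mem' := by
    rintro _ _ ⟨μ, ν, rfl⟩ ⟨μ', ν', rfl⟩
    refine ⟨μ + μ', ν + ν', ?_⟩
    rw [measureFunctional_add, measureFunctional_add]
    abel
  zero_mem' := ⟨0, 0, (sub_self _).symm⟩
  smul_mem' := by
    rintro c _ ⟨μ, ν, rfl⟩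
    rcases le_total 0 c with hc | hc
    · refine ⟨c.toNNReal • μ, c.toNNReal • ν, ?_⟩
      rw [measureFunctional_smul, measureFunctional_smul, Real.coe_toNNReal _ hc, smul_sub]
    · refine ⟨(-c).toNNReal • ν, (-c).toNNReal • μ, ?_⟩
      rw [measureFunctional_smul, measureFunctional_smul,
        Real.coe_toNNReal _ (neg_nonneg.2 hc)]
      ext f
      simp only [_root_.smul_apply, _root_.sub_apply, smul_eq_mul]
      ring

variable (d) in
/-- The Banach space `Z`: the closure of `M(ℝ^d)` in the dual of `C^{1+α}(ℝ^d)`, with the dual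
norm. -/
abbrev Z : Submodule ℝ (StrongDual ℝ (HolderC1 α (EuclideanSpace ℝ (Fin d)) ℝ)) :=
  (measureSubspace α d).topologicalClosure

/-- A finite positive Borel measure as an element of `Z`. -/
def toZ (μ : FiniteMeasure (EuclideanSpace ℝ (Fin d))) : Z α d :=
  ⟨measureFunctional α μ, Submodule.le_topologicalClosure _
    ⟨μ, 0, by rw [eq_sub_iff_add_eq, ← measureFunctional_add, add_zero]⟩⟩

end Space

/-- Weak measure solutions of `∂ₜ μ + div (v μ) = w μ` on `[0, ∞) × ℝ^d` with `μ = μ₀` at time `0`: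
narrowly continuous curves `t ↦ μ t` of finite positive Borel measures with
`∫₀^∞ ∫ (∂ₜ φ + v · ∇φ) dμₜ dt + ∫ φ(0, ·) dμ₀ = - ∫₀^∞ ∫ w φ dμₜ dt` for all `φ` in
`C_c^1([0, ∞) × ℝ^d)`. These `φ` are the restrictions to `[0, ∞) × ℝ^d` of the compactly supported
`C¹` functions on `ℝ × ℝ^d`. The topology of `FiniteMeasure` is that of narrow convergence. -/
def IsWeakSolution {d : ℕ} (v : ℝ≥0 → EuclideanSpace ℝ (Fin d) → EuclideanSpace ℝ (Fin d))
    (w : ℝ × EuclideanSpace ℝ (Fin d) → ℝ) (μ₀ : ProbabilityMeasure (EuclideanSpace ℝ (Fin d)))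
    (μ : ℝ≥0 → FiniteMeasure (EuclideanSpace ℝ (Fin d))) : Prop :=
  Continuous μ ∧
  ∀ φ : ℝ × EuclideanSpace ℝ (Fin d) → ℝ, ContDiff ℝ 1 φ → HasCompactSupport φ →
    (∫ t in Ioi (0 : ℝ), ∫ x, (fderiv ℝ φ (t, x) (1, 0) + fderiv ℝ φ (t, x) (0, v t.toNNReal x))
        ∂(μ t.toNNReal : Measure (EuclideanSpace ℝ (Fin d))))
      + ∫ x, φ (0, x) ∂(μ₀ : Measure (EuclideanSpace ℝ (Fin d)))
    = - ∫ t in Ioi (0 : ℝ), ∫ x, w (t, x) * φ (t, x)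
        ∂(μ t.toNNReal : Measure (EuclideanSpace ℝ (Fin d)))

end MeasureTransport

end

/-!
Weak solutions of `∂ₜ μ + div (v μ) = w μ` are transported along characteristics. With the flow `Φ`
of `v` and the accumulated weight `W t y = ∫₀ᵗ w (s, Φ s y) ds`, the solution is
`∫ f dμₜ = ∫ f (Φ t y) exp (W t y) dμ₀ y`, and both claims are read off from this formula.

*Characteristics.* The pair `(Φ, W)` is the flow of the augmented field `(v, w)` on `E × ℝ`, which is
again `C^{1+α}` in space, locally uniformly in time. Global solutions come from a contraction argument
(`exists_forall_hasDerivAt`). Grönwall's inequality yields the first order expansion of solutions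
(`IsHolderFamily.exists_norm_sub_sub_le`): with a Hölder derivative of the field, the error of the
linearization is of order `1 + α` in the perturbation, uniformly in the starting point. Perturbing the
initial value shows that the flow is `C¹` in `(t, y)`, and `(t, y) ↦ (t, Φ t y)` is a `C¹`
diffeomorphism by the inverse function theorem (`IsHolderFamily.exists_inverse_flow`). The
coefficients are only given for `t ≥ 0`; they are frozen at time `0` for negative times, so that the
flow is defined on all of `ℝ × E` and yields test functions there.

*Existence* (`IsTransported.isWeakSolution`). The derivative of `φ (t, Φ t y) exp (W t y)` in `t` is
the integrand of the weak formulation.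

*Uniqueness* (`IsWeakSolution.eq_of_isTransported`). The test functions
`η t * ζ y * exp (- W t y)`, where `y` is the starting point of the characteristic through `(t, x)`,
show that `μₜ`, pulled back to time `0` with the weight undone, does not depend on `t`
(`IsWeakSolution.integral_comp_inverse`). It therefore is `μ₀`, and `μₜ` is given by the formula.

*Differentiability* (`differentiableWithinAt_toZ`). Perturbing the field by `(h - h₀) b₁` in the same
expansion gives `(Φ, W)` to first order in `h`, uniformly in the starting point. Since `f (x) exp (z)`
has an `α`-Hölder derivative with constants proportional to the norm of `f`, the difference quotients
of `h ↦ ∫ f dμₜʰ` satisfy a Cauchy estimate that is uniform for `f` in the unit ball. The space `Z` is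
complete, as a closed subspace of a dual space, so the quotients converge in `Z`.
-/

namespace MeasureTransport

open Filter Topology
open scoped BoundedContinuousFunction

/-! ### Global solutions of ordinary differential equations and Grönwall's inequality -/

section ODE

variable {F : Type*} [NormedAddCommGroup F] [NormedSpace ℝ F]

theorem norm_le_of_norm_deriv_le_of_le {u u' : ℝ → F} {K ε T s t : ℝ} (hK : 0 ≤ K) (hε : 0 ≤ ε)
    (hu : ∀ r, HasDerivAt u (u' r) r) (bound : ∀ r, |r| ≤ T → ‖u' r‖ ≤ K * ‖u r‖ + ε)
    (hs : |s| ≤ T) (ht : |t| ≤ T) (hst : s ≤ t) :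
    ‖u t‖ ≤ (‖u s‖ + ε) * Real.exp ((K + 1) * (2 * T)) := by
  have hs' := abs_le.1 hs
  have ht' := abs_le.1 ht
  -- The exponent `K + 1` instead of `K` keeps the quotient `ε / K` in `gronwallBound` under control.
  have h := norm_le_gronwallBound_of_norm_deriv_right_le (f := u) (f' := u') (δ := ‖u s‖)
    (K := K + 1) (ε := ε) (a := s) (b := t)
    (fun r _ => (hu r).continuousAt.continuousWithinAt) (fun r _ => (hu r).hasDerivWithinAt)
    le_rfl (fun r hr => by
      refine (bound r (abs_le.2 ⟨by linarith [hr.1], by linarith [hr.2]⟩)).trans ?_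
      nlinarith [norm_nonneg (u r)]) t ⟨hst, le_rfl⟩
  rw [gronwallBound_of_K_ne_0 (by positivity)] at h
  have e1 : Real.exp ((K + 1) * (t - s)) ≤ Real.exp ((K + 1) * (2 * T)) := by
    gcongr
    linarith
  have e2 : ε / (K + 1) ≤ ε := div_le_self hε (by linarith)
  have e3 : 0 ≤ ε / (K + 1) := by positivity
  have e4 : 1 ≤ Real.exp ((K + 1) * (t - s)) :=
    Real.one_le_exp (mul_nonneg (by linarith) (by linarith))
  calc ‖u t‖ ≤ _ := h
    _ ≤ ‖u s‖ * Real.exp ((K + 1) * (t - s)) + ε * Real.exp ((K + 1) * (t - s)) :=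
        add_le_add le_rfl (mul_le_mul e2 (by linarith) (by linarith) hε)
    _ = (‖u s‖ + ε) * Real.exp ((K + 1) * (t - s)) := by ring
    _ ≤ _ := by gcongr

/-- Grönwall's inequality in both time directions, with a bound that is uniform in `[-T, T]`. -/
theorem norm_le_of_norm_deriv_le {u u' : ℝ → F} {K ε T s t : ℝ} (hK : 0 ≤ K) (hε : 0 ≤ ε)
    (hu : ∀ r, HasDerivAt u (u' r) r) (bound : ∀ r, |r| ≤ T → ‖u' r‖ ≤ K * ‖u r‖ + ε)
    (hs : |s| ≤ T) (ht : |t| ≤ T) :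
    ‖u t‖ ≤ (‖u s‖ + ε) * Real.exp ((K + 1) * (2 * T)) := by
  rcases le_total s t with hst | hst
  · exact norm_le_of_norm_deriv_le_of_le hK hε hu bound hs ht hst
  · have h := norm_le_of_norm_deriv_le_of_le (u := fun r => u (-r)) (u' := fun r => -u' (-r))
      (s := -s) (t := -t) hK hε (fun r => by
        simpa [Function.comp_def] using (hu (-r)).scomp r (hasDerivAt_neg r))
      (fun r hr => by simpa using bound (-r) (by simpa using hr)) (by simpa using hs)
      (by simpa using ht) (by linarith)
    simpa using h

/-- Global solvability for a globally Lipschitz field. The Picard operator is a contraction for the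
supremum norm weighted by `cosh (c * t)⁻¹`, as soon as `c` exceeds the Lipschitz constant. -/
theorem exists_forall_hasDerivAt_of_lipschitzWith [CompleteSpace F] {f : ℝ → F → F}
    (hf : Continuous fun p : ℝ × F => f p.1 p.2) {K : ℝ≥0} (hK : ∀ t, LipschitzWith K (f t)) {M : ℝ}
    (hM : ∀ t, ‖f t 0‖ ≤ M) (x₀ : F) :
    ∃ X : ℝ → F, X 0 = x₀ ∧ ∀ t, HasDerivAt X (f t (X t)) t := by
  set c : ℝ := 2 * K + 1 with hc
  have hc0 : 0 < c := by positivity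
  have hM0 : 0 ≤ M := (norm_nonneg _).trans (hM 0)
  have hint : ∀ (g : ℝ → F) (C : ℝ), (∀ s, ‖g s‖ ≤ C * Real.cosh (c * s)) → 0 ≤ C → ∀ t,
      ‖∫ s in (0 : ℝ)..t, g s‖ ≤ C / c * Real.cosh (c * t) := by
    intro g C hg hC t
    have h0 : ∫ s in (0 : ℝ)..t, C * Real.cosh (c * s) = C / c * Real.sinh (c * t) := by
      have hd : ∀ s ∈ uIcc (0 : ℝ) t,
          HasDerivAt (fun s => C / c * Real.sinh (c * s)) (C * Real.cosh (c * s)) s := by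
        intro s _
        have := (((hasDerivAt_id s).const_mul c).sinh).const_mul (C / c)
        convert! this using 1
        simp only [id]
        field_simp
      rw [intervalIntegral.integral_eq_sub_of_hasDerivAt hd
        (Continuous.intervalIntegrable (by fun_prop) _ _)]
      simp
    refine (intervalIntegral.norm_integral_le_abs_of_norm_le
      (Filter.Eventually.of_forall fun s => hg s)
      (Continuous.intervalIntegrable (by fun_prop) _ _)).trans ?_
    rw [h0, abs_mul, abs_of_nonneg (by positivity)]
    gcongr
    rw [abs_le]
    constructor
    · have := Real.exp_pos (c * t)
      rw [← Real.cosh_add_sinh] at this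
      linarith
    · exact (Real.sinh_lt_cosh _).le
  have hfc : ∀ u : ℝ →ᵇ F, Continuous fun s => f s (Real.cosh (c * s) • u s) := fun u => by
    have : Continuous fun s => Real.cosh (c * s) • u s := by fun_prop
    exact hf.comp (continuous_id.prodMk this)
  have hbd : ∀ (u : ℝ →ᵇ F) (t : ℝ),
      ‖(Real.cosh (c * t))⁻¹ • (x₀ + ∫ s in (0 : ℝ)..t, f s (Real.cosh (c * s) • u s))‖
        ≤ ‖x₀‖ + (M + K * ‖u‖) / c := by
    intro u t
    have h1 := hint (fun s => f s (Real.cosh (c * s) • u s)) (M + K * ‖u‖) (fun s => by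
      have h := (hK s).dist_le_mul (Real.cosh (c * s) • u s) 0
      rw [dist_zero_right, dist_eq_norm, norm_smul, Real.norm_of_nonneg (Real.cosh_pos _).le] at h
      have h2 := norm_le_norm_add_norm_sub' (f s (Real.cosh (c * s) • u s)) (f s 0)
      have h3 := u.norm_coe_le_norm s
      have h4 := Real.one_le_cosh (c * s)
      calc ‖f s (Real.cosh (c * s) • u s)‖ ≤ M + K * (Real.cosh (c * s) * ‖u s‖) := by
            linarith [hM s]
        _ ≤ M * Real.cosh (c * s) + K * (Real.cosh (c * s) * ‖u‖) := by
            gcongr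
            exact le_mul_of_one_le_right hM0 h4
        _ = _ := by ring) (by positivity) t
    have h4 := Real.one_le_cosh (c * t)
    rw [norm_smul, norm_inv, Real.norm_of_nonneg (Real.cosh_pos _).le]
    rw [inv_mul_le_iff₀ (Real.cosh_pos _)]
    refine (norm_add_le _ _).trans ?_
    nlinarith [norm_nonneg x₀]
  let N : (ℝ →ᵇ F) → (ℝ →ᵇ F) := fun u => BoundedContinuousFunction.ofNormedAddCommGroup
    (fun t => (Real.cosh (c * t))⁻¹ • (x₀ + ∫ s in (0 : ℝ)..t, f s (Real.cosh (c * s) • u s)))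
    (by
      refine Continuous.smul (Continuous.inv₀ (by fun_prop) fun t => (Real.cosh_pos _).ne')
        (continuous_const.add ?_)
      exact intervalIntegral.continuous_primitive
        (fun _ _ => (hfc u).intervalIntegrable _ _) 0) _ (hbd u)
  have hNc : ContractingWith (1 / 2) N := by
    refine ⟨by norm_num [← NNReal.coe_lt_coe], LipschitzWith.of_dist_le_mul fun u v => ?_⟩
    refine (BoundedContinuousFunction.dist_le (by positivity)).2 fun t => ?_
    have h1 := hint (fun s => f s (Real.cosh (c * s) • u s) - f s (Real.cosh (c * s) • v s))
      (K * dist u v) (fun s => by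
        have h := (hK s).dist_le_mul (Real.cosh (c * s) • u s) (Real.cosh (c * s) • v s)
        rw [dist_eq_norm, dist_eq_norm, ← smul_sub, norm_smul,
          Real.norm_of_nonneg (Real.cosh_pos _).le] at h
        have h3 := BoundedContinuousFunction.dist_coe_le_dist (f := u) (g := v) s
        rw [dist_eq_norm] at h3
        have h4 := Real.cosh_pos (c * s)
        calc _ ≤ K * (Real.cosh (c * s) * ‖u s - v s‖) := h
          _ ≤ K * (Real.cosh (c * s) * dist u v) := by gcongr
          _ = _ := by ring) (by positivity) t
    rw [intervalIntegral.integral_sub ((hfc u).intervalIntegrable _ _)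
      ((hfc v).intervalIntegrable _ _)] at h1
    simp only [N, BoundedContinuousFunction.coe_ofNormedAddCommGroup]
    rw [dist_eq_norm, ← smul_sub, norm_smul, norm_inv,
      Real.norm_of_nonneg (Real.cosh_pos _).le, inv_mul_le_iff₀ (Real.cosh_pos _),
      add_sub_add_left_eq_sub]
    refine h1.trans ?_
    have h5 : (K : ℝ) * dist u v / c ≤ 1 / 2 * dist u v := by
      rw [div_le_iff₀ hc0, hc]
      nlinarith [dist_nonneg (x := u) (y := v)]
    have := mul_le_mul_of_nonneg_right h5 (Real.cosh_pos (c * t)).le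
    push_cast
    linarith
  obtain ⟨u, hu, -⟩ := hNc.exists_fixedPoint 0 (edist_ne_top _ _)
  have hX : ∀ t, Real.cosh (c * t) • u t
      = x₀ + ∫ s in (0 : ℝ)..t, f s (Real.cosh (c * s) • u s) := by
    intro t
    have h : N u t = u t := by rw [hu]
    rw [← h]
    simp only [N, BoundedContinuousFunction.coe_ofNormedAddCommGroup]
    rw [smul_smul, mul_inv_cancel₀ (Real.cosh_pos _).ne', one_smul]
  refine ⟨fun t => Real.cosh (c * t) • u t, (hX 0).trans (by simp), fun t => ?_⟩
  have := (intervalIntegral.integral_hasDerivAt_right ((hfc u).intervalIntegrable 0 t)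
    (hfc u).stronglyMeasurable.stronglyMeasurableAtFilter (hfc u).continuousAt).const_add x₀
  exact this.congr_of_eventuallyEq (Filter.Eventually.of_forall hX)

/-- Global solvability for a field with Lipschitz constants that are locally bounded in time. The
solutions for the fields frozen outside `[-T, T]` are glued along increasing `T`. -/
theorem exists_forall_hasDerivAt [CompleteSpace F] {f : ℝ → F → F}
    (hf : Continuous fun p : ℝ × F => f p.1 p.2)
    (hK : ∀ T : ℝ, ∃ K : ℝ≥0, ∀ t, |t| ≤ T → LipschitzWith K (f t)) (x₀ : F) :
    ∃ X : ℝ → F, X 0 = x₀ ∧ ∀ t, HasDerivAt X (f t (X t)) t := by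
  have key : ∀ T : ℝ, 0 ≤ T →
      ∃ X : ℝ → F, X 0 = x₀ ∧ ∀ t, HasDerivAt X (f (max (-T) (min t T)) (X t)) t := by
    intro T hT
    have hcl : ∀ t, |max (-T) (min t T)| ≤ T := fun t =>
      abs_le.2 ⟨le_max_left _ _, max_le (by linarith) (min_le_right _ _)⟩
    obtain ⟨K, hK⟩ := hK T
    have hcont : Continuous fun t => f t 0 := hf.comp (continuous_id.prodMk continuous_const)
    obtain ⟨M, hM⟩ := (isCompact_Icc (a := -T) (b := T)).exists_bound_of_continuousOn
      hcont.continuousOn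
    exact exists_forall_hasDerivAt_of_lipschitzWith (f := fun t => f (max (-T) (min t T)))
      (hf.comp (f := fun p : ℝ × F => (max (-T) (min p.1 T), p.2)) (by fun_prop)) (fun t => hK _ (hcl t)) (fun t => hM _ (abs_le.1 (hcl t))) x₀
  choose! X hX0 hX using key
  have hcl : ∀ {T t : ℝ}, |t| ≤ T → max (-T) (min t T) = t := fun {T t} h => by
    rw [min_eq_left (abs_le.1 h).2, max_eq_right (abs_le.1 h).1]
  have agree : ∀ {S T t : ℝ}, |t| ≤ S → S ≤ T → X S t = X T t := by
    intro S T t ht hST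
    have hS : 0 ≤ S := (abs_nonneg t).trans ht
    obtain ⟨K, hK⟩ := hK S
    have h := norm_le_of_norm_deriv_le (u := fun t => X S t - X T t) (K := K) (ε := 0) (T := S)
      (s := 0) (t := t) K.2 le_rfl (fun r => (hX S hS r).sub (hX T (hS.trans hST) r))
      (fun r hr => by
        have := (hK r hr).dist_le_mul (X S r) (X T r)
        rw [hcl hr, hcl (hr.trans hST), add_zero]
        rwa [dist_eq_norm, dist_eq_norm] at this) (by simpa using hS) ht
    rw [hX0 S hS, hX0 T (hS.trans hST)] at h
    simpa [sub_eq_zero] using h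
  refine ⟨fun t => X (|t| + 1) t, hX0 _ (by positivity), fun t => ?_⟩
  have h := hX (|t| + 2) (by positivity) t
  rw [hcl (by linarith)] at h
  have e : ∀ s, |s| ≤ |t| + 1 → X (|s| + 1) s = X (|t| + 2) s := fun s hs =>
    agree (by linarith) (by linarith)
  simp only [e t (by linarith)]
  refine h.congr_of_eventuallyEq ?_
  have : ∀ᶠ s in 𝓝 t, |s| < |t| + 1 := continuous_abs.continuousAt.eventually_lt
    continuousAt_const (by simp)
  exact this.mono fun s hs => e s hs.le

theorem exists_forall_hasDerivAt_of_initial_time [CompleteSpace F] {f : ℝ → F → F}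
    (hf : Continuous fun p : ℝ × F => f p.1 p.2)
    (hK : ∀ T : ℝ, ∃ K : ℝ≥0, ∀ t, |t| ≤ T → LipschitzWith K (f t)) (t₀ : ℝ) (x₀ : F) :
    ∃ X : ℝ → F, X t₀ = x₀ ∧ ∀ t, HasDerivAt X (f t (X t)) t := by
  obtain ⟨X, h0, hX⟩ := exists_forall_hasDerivAt (f := fun t => f (t + t₀))
    (hf.comp (f := fun p : ℝ × F => (p.1 + t₀, p.2)) (by fun_prop)) (fun T => by
      obtain ⟨K, hK⟩ := hK (T + |t₀|)
      exact ⟨K, fun t ht => hK _ ((abs_add_le _ _).trans (by linarith))⟩) x₀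
  refine ⟨fun t => X (t - t₀), by simpa using h0, fun t => ?_⟩
  simpa using (hX (t - t₀)).comp_sub_const t t₀

end ODE

/-! ### Flows of fields with Hölder continuous spatial derivative -/

section Taylor

variable {E G : Type*} [NormedAddCommGroup E] [NormedSpace ℝ E] [NormedAddCommGroup G]
  [NormedSpace ℝ G]

theorem norm_sub_sub_le_of_holder {f : E → G} {f' : E → E →L[ℝ] G} {K α : ℝ} (hK : 0 ≤ K)
    (hα : 0 ≤ α) (hf : ∀ x, HasFDerivAt f (f' x) x)
    (h : ∀ x y, ‖f' x - f' y‖ ≤ K * ‖x - y‖ ^ α) (x y : E) :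
    ‖f y - f x - f' x (y - x)‖ ≤ K * ‖y - x‖ ^ (1 + α) := by
  have key := Convex.norm_image_sub_le_of_norm_hasFDerivWithin_le' (f := f) (f' := f')
    (φ := f' x) (s := segment ℝ x y) (x := x) (y := y) (C := K * ‖y - x‖ ^ α)
    (fun z _ => (hf z).hasFDerivWithinAt) (fun z hz => by
      refine (h z x).trans ?_
      gcongr
      obtain ⟨θ, hθ, rfl⟩ := (segment_eq_image' ℝ x y ▸ hz)
      rw [add_sub_cancel_left, norm_smul, Real.norm_of_nonneg hθ.1]
      exact mul_le_of_le_one_left (norm_nonneg _) hθ.2) (convex_segment x y)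
    (left_mem_segment ℝ x y) (right_mem_segment ℝ x y)
  refine key.trans (le_of_eq ?_)
  rw [Real.rpow_add_of_nonneg (norm_nonneg _) zero_le_one hα, Real.rpow_one]
  ring

theorem hasFDerivWithinAt_of_norm_le_rpow {f : E → G} {A : E →L[ℝ] G} {C α : ℝ} {s : Set E} {x : E}
    (hα : 0 < α) (h : ∀ y ∈ s, ‖f y - f x - A (y - x)‖ ≤ C * ‖y - x‖ ^ (1 + α)) :
    HasFDerivWithinAt f A s x := by
  rw [hasFDerivWithinAt_iff_isLittleO]
  have h1 : (fun y => f y - f x - A (y - x)) =O[𝓝[s] x] fun y => ‖y - x‖ ^ (1 + α) := by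
    refine Asymptotics.IsBigO.of_bound C ?_
    filter_upwards [self_mem_nhdsWithin] with y hy
    rw [Real.norm_of_nonneg (by positivity)]
    exact h y hy
  refine h1.trans_isLittleO ?_
  have h2 : (fun y => ‖y - x‖ * ‖y - x‖ ^ α) =o[𝓝[s] x] fun y => ‖y - x‖ * 1 := by
    refine (Asymptotics.isBigO_refl _ _).mul_isLittleO ?_
    rw [Asymptotics.isLittleO_one_iff]
    have : Continuous fun y => ‖y - x‖ ^ α :=
      (continuous_norm.comp (continuous_id.sub continuous_const)).rpow_const fun _ => Or.inr hα.le
    have h3 := this.tendsto x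
    simp only [sub_self, norm_zero, Real.zero_rpow hα.ne'] at h3
    exact h3.mono_left nhdsWithin_le_nhds
  simp only [mul_one] at h2
  refine (Asymptotics.IsLittleO.of_norm_right h2).congr_left fun y => ?_
  rw [Real.rpow_add_of_nonneg (norm_nonneg _) zero_le_one hα.le, Real.rpow_one]

end Taylor

/-- A time-dependent family of maps `V t : E → G` with spatial derivatives `DV t`, jointly continuous
and bounded in `C^{1+α}` locally uniformly in time. Time runs through all of `ℝ`. -/
structure IsHolderFamily {E G : Type*} [NormedAddCommGroup E] [NormedSpace ℝ E]
    [NormedAddCommGroup G] [NormedSpace ℝ G] (α : ℝ≥0) (V : ℝ → E → G) (DV : ℝ → E → E →L[ℝ] G) :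
    Prop where
  continuous : Continuous fun p : ℝ × E => V p.1 p.2
  hasFDerivAt : ∀ t x, HasFDerivAt (V t) (DV t x) x
  continuous_deriv : Continuous fun p : ℝ × E => DV p.1 p.2
  exists_bound : ∀ T : ℝ, ∃ K : ℝ, 0 ≤ K ∧ ∀ t, |t| ≤ T → ∀ x, ‖V t x‖ ≤ K ∧ ‖DV t x‖ ≤ K ∧
    ∀ y, ‖DV t x - DV t y‖ ≤ K * ‖x - y‖ ^ (α : ℝ)

/-- `Φ t y` is the position at time `t` of the solution of `X' = V(t, X)` with `X(0) = y`. -/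
structure IsFlow {F : Type*} [NormedAddCommGroup F] [NormedSpace ℝ F] (V : ℝ → F → F)
    (Φ : ℝ → F → F) : Prop where
  zero : ∀ y, Φ 0 y = y
  hasDerivAt : ∀ y t, HasDerivAt (fun s => Φ s y) (V t (Φ t y)) t

namespace IsHolderFamily

section Operations

variable {E G H : Type*} [NormedAddCommGroup E] [NormedSpace ℝ E] [NormedAddCommGroup G]
  [NormedSpace ℝ G] [NormedAddCommGroup H] [NormedSpace ℝ H] {α : ℝ≥0}

theorem add {V W : ℝ → E → G} {DV DW : ℝ → E → E →L[ℝ] G} (hV : IsHolderFamily α V DV)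
    (hW : IsHolderFamily α W DW) :
    IsHolderFamily α (fun t x => V t x + W t x) (fun t x => DV t x + DW t x) where
  continuous := hV.continuous.add hW.continuous
  hasFDerivAt t x := (hV.hasFDerivAt t x).add (hW.hasFDerivAt t x)
  continuous_deriv := hV.continuous_deriv.add hW.continuous_deriv
  exists_bound T := by
    obtain ⟨K, hK, h⟩ := hV.exists_bound T
    obtain ⟨L, hL, k⟩ := hW.exists_bound T
    refine ⟨K + L, by positivity, fun t ht x => ?_⟩
    obtain ⟨h1, h2, h3⟩ := h t ht x
    obtain ⟨k1, k2, k3⟩ := k t ht x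
    refine ⟨norm_add_le_of_le h1 k1, norm_add_le_of_le h2 k2, fun y => ?_⟩
    rw [add_sub_add_comm, add_mul]
    exact norm_add_le_of_le (h3 y) (k3 y)

theorem const_smul {V : ℝ → E → G} {DV : ℝ → E → E →L[ℝ] G} (hV : IsHolderFamily α V DV) (c : ℝ) :
    IsHolderFamily α (fun t x => c • V t x) (fun t x => c • DV t x) where
  continuous := hV.continuous.const_smul c
  hasFDerivAt t x := (hV.hasFDerivAt t x).const_smul c
  continuous_deriv := hV.continuous_deriv.const_smul c
  exists_bound T := by
    obtain ⟨K, hK, h⟩ := hV.exists_bound T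
    refine ⟨|c| * K, by positivity, fun t ht x => ?_⟩
    obtain ⟨h1, h2, h3⟩ := h t ht x
    refine ⟨?_, ?_, fun y => ?_⟩
    · rw [norm_smul, Real.norm_eq_abs]
      gcongr
    · rw [norm_smul, Real.norm_eq_abs]
      gcongr
    · rw [← smul_sub, norm_smul, Real.norm_eq_abs, mul_assoc]
      exact mul_le_mul_of_nonneg_left (h3 y) (abs_nonneg c)

theorem prodMk {V : ℝ → E → G} {DV : ℝ → E → E →L[ℝ] G} {W : ℝ → E → H} {DW : ℝ → E → E →L[ℝ] H}
    (hV : IsHolderFamily α V DV) (hW : IsHolderFamily α W DW) :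
    IsHolderFamily α (fun t x => (V t x, W t x)) (fun t x => (DV t x).prod (DW t x)) where
  continuous := hV.continuous.prodMk hW.continuous
  hasFDerivAt t x := (hV.hasFDerivAt t x).prodMk (hW.hasFDerivAt t x)
  continuous_deriv :=
    (ContinuousLinearMap.prodₗᵢ ℝ).continuous.comp
      (hV.continuous_deriv.prodMk hW.continuous_deriv)
  exists_bound T := by
    obtain ⟨K, hK, h⟩ := hV.exists_bound T
    obtain ⟨L, hL, k⟩ := hW.exists_bound T
    refine ⟨max K L, le_max_of_le_left hK, fun t ht x => ?_⟩
    obtain ⟨h1, h2, h3⟩ := h t ht x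
    obtain ⟨k1, k2, k3⟩ := k t ht x
    refine ⟨max_le_max h1 k1, ?_, fun y => ?_⟩
    · rw [ContinuousLinearMap.opNorm_prod]
      exact max_le_max h2 k2
    · have : (DV t x).prod (DW t x) - (DV t y).prod (DW t y)
          = (DV t x - DV t y).prod (DW t x - DW t y) := rfl
      rw [this, ContinuousLinearMap.opNorm_prod]
      refine max_le ((h3 y).trans ?_) ((k3 y).trans ?_)
      · gcongr
        exact le_max_left _ _
      · gcongr
        exact le_max_right _ _

theorem comp_fst {V : ℝ → E → G} {DV : ℝ → E → E →L[ℝ] G} (hV : IsHolderFamily α V DV) :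
    IsHolderFamily α (fun t (p : E × H) => V t p.1)
      (fun t p => (DV t p.1).comp (ContinuousLinearMap.fst ℝ E H)) where
  continuous := hV.continuous.comp (f := fun p : ℝ × E × H => (p.1, p.2.1)) (by fun_prop)
  hasFDerivAt t p := (hV.hasFDerivAt t p.1).comp p hasFDerivAt_fst
  continuous_deriv :=
    (hV.continuous_deriv.comp (f := fun p : ℝ × E × H => (p.1, p.2.1)) (by fun_prop)).clm_comp
      continuous_const
  exists_bound T := by
    obtain ⟨K, hK, h⟩ := hV.exists_bound T
    have hfst : ∀ A : E →L[ℝ] G, ‖A.comp (ContinuousLinearMap.fst ℝ E H)‖ ≤ ‖A‖ := fun A =>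
      (A.opNorm_comp_le _).trans
        (mul_le_of_le_one_right (norm_nonneg _) (ContinuousLinearMap.norm_fst_le ℝ E H))
    refine ⟨K, hK, fun t ht x => ?_⟩
    obtain ⟨h1, h2, h3⟩ := h t ht x.1
    refine ⟨h1, (hfst _).trans h2, fun y => ?_⟩
    rw [← ContinuousLinearMap.sub_comp]
    refine (hfst _).trans ((h3 y.1).trans ?_)
    gcongr
    exact norm_fst_le (x - y)

theorem norm_sub_le {V : ℝ → E → G} {DV : ℝ → E → E →L[ℝ] G} (hV : IsHolderFamily α V DV) {K t : ℝ}
    (hK : ∀ x, ‖DV t x‖ ≤ K) (x y : E) : ‖V t x - V t y‖ ≤ K * ‖x - y‖ :=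
  Convex.norm_image_sub_le_of_norm_hasFDerivWithin_le (f := V t) (s := univ)
    (fun z _ => (hV.hasFDerivAt t z).hasFDerivWithinAt) (fun z _ => hK z) convex_univ
    (mem_univ _) (mem_univ _)

theorem exists_lipschitzWith {V : ℝ → E → G} {DV : ℝ → E → E →L[ℝ] G} (hV : IsHolderFamily α V DV)
    (T : ℝ) : ∃ K : ℝ≥0, ∀ t, |t| ≤ T → LipschitzWith K (V t) := by
  obtain ⟨K, hK, h⟩ := hV.exists_bound T
  refine ⟨⟨K, hK⟩, fun t ht => LipschitzWith.of_dist_le_mul fun x y => ?_⟩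
  rw [dist_eq_norm, dist_eq_norm]
  exact hV.norm_sub_le (fun x => (h t ht x).2.1) x y

end Operations

section Flow

variable {F : Type*} [NormedAddCommGroup F] [NormedSpace ℝ F] {α : ℝ≥0} {V : ℝ → F → F}
  {DV : ℝ → F → F →L[ℝ] F}

theorem exists_isFlow [CompleteSpace F] (hV : IsHolderFamily α V DV) : ∃ Φ, IsFlow V Φ := by
  choose Φ h0 h using fun y => exists_forall_hasDerivAt hV.continuous hV.exists_lipschitzWith y
  exact ⟨fun t y => Φ y t, h0, h⟩

theorem eq_of_hasDerivAt (hV : IsHolderFamily α V DV) {X Y : ℝ → F}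
    (hX : ∀ t, HasDerivAt X (V t (X t)) t) (hY : ∀ t, HasDerivAt Y (V t (Y t)) t) {s : ℝ}
    (h : X s = Y s) (t : ℝ) : X t = Y t := by
  obtain ⟨K, hK, hb⟩ := hV.exists_bound (max |s| |t|)
  have := norm_le_of_norm_deriv_le (u := fun t => X t - Y t) hK le_rfl
    (fun r => (hX r).sub (hY r)) (fun r hr => by
      rw [add_zero]
      exact hV.norm_sub_le (fun x => (hb r hr x).2.1) _ _) (le_max_left |s| |t|) (le_max_right _ _)
  rw [h] at this
  simpa [sub_eq_zero] using this

/-- Solutions of a perturbed equation stay close to solutions of the equation. -/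
theorem exists_norm_sub_le (hV : IsHolderFamily α V DV) (T : ℝ) :
    ∃ C : ℝ, 0 ≤ C ∧ ∀ (X Y r : ℝ → F) (ε : ℝ), 0 ≤ ε →
      (∀ t, HasDerivAt X (V t (X t)) t) → (∀ t, HasDerivAt Y (V t (Y t) + r t) t) →
      (∀ t, |t| ≤ T → ‖r t‖ ≤ ε) → ∀ t, |t| ≤ T → ‖Y t - X t‖ ≤ C * (‖Y 0 - X 0‖ + ε) := by
  obtain ⟨K, hK, hb⟩ := hV.exists_bound T
  refine ⟨Real.exp ((K + 1) * (2 * T)), by positivity, fun X Y r ε hε hX hY hr t ht => ?_⟩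
  rw [mul_comm]
  refine norm_le_of_norm_deriv_le (u := fun t => Y t - X t) hK hε
    (fun r => (hY r).sub (hX r)) (fun s hs => ?_) (by simpa using (abs_nonneg t).trans ht) ht
  rw [add_sub_right_comm]
  exact norm_add_le_of_le (hV.norm_sub_le (fun x => (hb s hs x).2.1) _ _) (hr s hs)

/-- First order expansion of solutions: if `X` solves the equation, `X'` the equation perturbed by
`r'`, and `Y` the equation linearized along `X` with source `r`, then `X' - X - Y` is of order
`1 + α` in the distance of `X` and `X'`, up to the initial error and the error in the source. -/
theorem exists_norm_sub_sub_le (hV : IsHolderFamily α V DV) (T : ℝ) :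
    ∃ C : ℝ, 0 ≤ C ∧ ∀ (X X' Y r r' : ℝ → F) (ρ ε : ℝ), 0 ≤ ρ → 0 ≤ ε →
      (∀ t, HasDerivAt X (V t (X t)) t) → (∀ t, HasDerivAt X' (V t (X' t) + r' t) t) →
      (∀ t, HasDerivAt Y (DV t (X t) (Y t) + r t) t) →
      (∀ t, |t| ≤ T → ‖X' t - X t‖ ≤ ρ) → (∀ t, |t| ≤ T → ‖r' t - r t‖ ≤ ε) →
      ∀ t, |t| ≤ T →
        ‖X' t - X t - Y t‖ ≤ C * (‖X' 0 - X 0 - Y 0‖ + ρ ^ (1 + α : ℝ) + ε) := by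
  obtain ⟨K, hK, hb⟩ := hV.exists_bound T
  refine ⟨(K + 1) * Real.exp ((K + 1) * (2 * T)), by positivity,
    fun X X' Y r r' ρ ε hρ hε hX hX' hY hd hr t ht => ?_⟩
  have h := norm_le_of_norm_deriv_le (u := fun t => X' t - X t - Y t) (ε := K * ρ ^ (1 + α : ℝ) + ε)
    (s := 0) (t := t) hK (by positivity) (fun s => ((hX' s).sub (hX s)).sub (hY s))
    (fun s hs => ?_) (by simpa using (abs_nonneg t).trans ht) ht
  · refine h.trans ?_
    have h1 : 0 ≤ ρ ^ (1 + α : ℝ) := by positivity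
    rw [mul_comm, mul_comm (K + 1) (Real.exp _), mul_assoc]
    refine mul_le_mul_of_nonneg_left ?_ (Real.exp_pos _).le
    nlinarith [mul_nonneg hK hε, norm_nonneg (X' 0 - X 0 - Y 0),
      mul_nonneg hK (norm_nonneg (X' 0 - X 0 - Y 0))]
  · have e : V s (X' s) + r' s - V s (X s) - (DV s (X s) (Y s) + r s)
        = DV s (X s) (X' s - X s - Y s)
          + ((V s (X' s) - V s (X s) - DV s (X s) (X' s - X s)) + (r' s - r s)) := by
      simp only [map_sub]
      abel
    rw [e]
    refine norm_add_le_of_le ((DV s (X s)).le_of_opNorm_le (hb s hs _).2.1 _)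
      (norm_add_le_of_le ?_ (hr s hs))
    refine (norm_sub_sub_le_of_holder hK α.2 (hV.hasFDerivAt s) (fun x => (hb s hs x).2.2) _
      _).trans ?_
    exact mul_le_mul_of_nonneg_left
      (Real.rpow_le_rpow (norm_nonneg _) (hd s hs) (add_nonneg zero_le_one α.2)) hK

theorem exists_norm_flow_sub_le (hV : IsHolderFamily α V DV) {Φ : ℝ → F → F} (hΦ : IsFlow V Φ)
    (T : ℝ) : ∃ C : ℝ, 0 ≤ C ∧ ∀ y y' t, |t| ≤ T → ‖Φ t y' - Φ t y‖ ≤ C * ‖y' - y‖ := by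
  obtain ⟨C, hC, h⟩ := hV.exists_norm_sub_le T
  refine ⟨C, hC, fun y y' t ht => ?_⟩
  have := h _ _ (fun _ => 0) 0 le_rfl (hΦ.hasDerivAt y)
    (fun t => by simpa using hΦ.hasDerivAt y' t) (fun _ _ => by simp) t ht
  simpa [hΦ.zero] using this

theorem continuous_flow (hV : IsHolderFamily α V DV) {Φ : ℝ → F → F} (hΦ : IsFlow V Φ) :
    Continuous fun p : ℝ × F => Φ p.1 p.2 := by
  rw [continuous_iff_continuousAt]
  rintro ⟨t₀, y₀⟩
  obtain ⟨C, hC, hd⟩ := hV.exists_norm_flow_sub_le hΦ (|t₀| + 1)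
  have h := continuousOn_prod_of_continuousOn_lipschitzOnWith' (fun p : ℝ × F => Φ p.1 p.2)
    (s := {t | |t| < |t₀| + 1}) (t := univ) ⟨C, hC⟩
    (fun t ht => LipschitzOnWith.of_dist_le_mul fun y _ y' _ => by
      rw [dist_eq_norm, dist_eq_norm]
      exact hd y' y t (le_of_lt ht))
    (fun y _ t _ => (hΦ.hasDerivAt y t).continuousAt.continuousWithinAt)
  refine h.continuousAt (prod_mem_nhds ((isOpen_lt continuous_abs continuous_const).mem_nhds ?_)
    univ_mem)
  simp

/-- The derivative of the flow in the initial value: the solution of the linearized equation with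
initial value the identity. It inherits the Hölder continuity of `DV`, locally uniformly in time. -/
theorem exists_fderiv_flow [CompleteSpace F] (hα : 0 < α) (hV : IsHolderFamily α V DV)
    {Φ : ℝ → F → F} (hΦ : IsFlow V Φ) :
    ∃ J : ℝ → F → F →L[ℝ] F, (∀ y, J 0 y = ContinuousLinearMap.id ℝ F) ∧
      (∀ y t, HasDerivAt (fun s => J s y) ((DV t (Φ t y)).comp (J t y)) t) ∧
      (Continuous fun p : ℝ × F => J p.1 p.2) ∧ ∀ t y, HasFDerivAt (Φ t) (J t y) y := by
  have hcont : ∀ y, Continuous fun t => DV t (Φ t y) := fun y =>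
    hV.continuous_deriv.comp (continuous_id.prodMk
      (continuous_iff_continuousAt.2 fun t => (hΦ.hasDerivAt y t).continuousAt))
  choose J hJ0 hJ using fun y => exists_forall_hasDerivAt
    (f := fun t (A : F →L[ℝ] F) => (DV t (Φ t y)).comp A)
    (((hcont y).comp continuous_fst).clm_comp continuous_snd) (fun T => by
      obtain ⟨K, hK, hb⟩ := hV.exists_bound T
      refine ⟨⟨K, hK⟩, fun t ht => LipschitzWith.of_dist_le_mul fun A B => ?_⟩
      rw [dist_eq_norm, dist_eq_norm, ← ContinuousLinearMap.comp_sub]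
      refine (ContinuousLinearMap.opNorm_comp_le _ _).trans ?_
      gcongr
      exact (hb t ht _).2.1) (ContinuousLinearMap.id ℝ F)
  refine ⟨fun t y => J y t, hJ0, hJ, ?_, fun t y => ?_⟩
  · rw [continuous_iff_continuousAt]
    rintro ⟨t₀, y₀⟩
    set T := |t₀| + 1
    have hT : 0 ≤ T := by positivity
    obtain ⟨K, hK, hb⟩ := hV.exists_bound T
    obtain ⟨C, hC, hd⟩ := hV.exists_norm_flow_sub_le hΦ T
    set M := Real.exp ((K + 1) * (2 * T))
    have hJb : ∀ t, |t| ≤ T → ‖J y₀ t‖ ≤ M := fun t ht => by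
      have := norm_le_of_norm_deriv_le hK le_rfl (hJ y₀) (fun r hr => by
        rw [add_zero]
        refine (ContinuousLinearMap.opNorm_comp_le _ _).trans ?_
        gcongr
        exact (hb r hr _).2.1) (s := 0) (by simpa using hT) ht
      refine this.trans (mul_le_of_le_one_left (by positivity) ?_)
      rw [hJ0, add_zero]
      exact ContinuousLinearMap.norm_id_le
    have hJd : ∀ y t, |t| ≤ T →
        ‖J y t - J y₀ t‖ ≤ K * (C * ‖y - y₀‖) ^ (α : ℝ) * M * M := fun y t ht => by
      have := norm_le_of_norm_deriv_le (u := fun t => J y t - J y₀ t)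
        (ε := K * (C * ‖y - y₀‖) ^ (α : ℝ) * M) hK (by positivity)
        (fun r => (hJ y r).sub (hJ y₀ r)) (fun r hr => by
          have e : (DV r (Φ r y)).comp (J y r) - (DV r (Φ r y₀)).comp (J y₀ r)
              = (DV r (Φ r y)).comp (J y r - J y₀ r)
                + (DV r (Φ r y) - DV r (Φ r y₀)).comp (J y₀ r) := by
            rw [ContinuousLinearMap.comp_sub, ContinuousLinearMap.sub_comp]
            abel
          rw [e]
          refine norm_add_le_of_le ((ContinuousLinearMap.opNorm_comp_le _ _).trans ?_)
            ((ContinuousLinearMap.opNorm_comp_le _ _).trans ?_)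
          · gcongr
            exact (hb r hr _).2.1
          · gcongr
            · refine ((hb r hr _).2.2 _).trans ?_
              gcongr
              exact hd y₀ y r hr
            · exact hJb r hr) (s := 0) (by simpa using hT) ht
      simpa [hJ0] using this
    rw [ContinuousAt, tendsto_iff_norm_sub_tendsto_zero]
    have hlim : Tendsto (fun p : ℝ × F => K * (C * ‖p.2 - y₀‖) ^ (α : ℝ) * M * M
        + ‖J y₀ p.1 - J y₀ t₀‖) (𝓝 (t₀, y₀)) (𝓝 0) := by
      have hJc : Continuous (J y₀) :=
        continuous_iff_continuousAt.2 fun t => (hJ y₀ t).continuousAt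
      have : Continuous fun p : ℝ × F => K * (C * ‖p.2 - y₀‖) ^ (α : ℝ) * M * M
          + ‖J y₀ p.1 - J y₀ t₀‖ := by
        have h1 : Continuous fun p : ℝ × F => (C * ‖p.2 - y₀‖) ^ (α : ℝ) :=
          Continuous.rpow_const (by fun_prop) fun _ => Or.inr α.2
        fun_prop
      have h := this.tendsto (t₀, y₀)
      simpa [Real.zero_rpow (NNReal.coe_pos.2 hα).ne'] using h
    refine squeeze_zero' (Eventually.of_forall fun _ => norm_nonneg _) ?_ hlim
    have hev : ∀ᶠ p : ℝ × F in 𝓝 (t₀, y₀), |p.1| < T :=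
      (continuous_abs.comp continuous_fst).continuousAt.eventually_lt continuousAt_const
        (by simp [T])
    filter_upwards [hev] with p hp
    refine (norm_sub_le_norm_sub_add_norm_sub _ (J y₀ p.1) _).trans ?_
    gcongr
    exact hJd p.2 p.1 hp.le
  · obtain ⟨C, hC, hd⟩ := hV.exists_norm_flow_sub_le hΦ |t|
    obtain ⟨D, hD, hl⟩ := hV.exists_norm_sub_sub_le |t|
    rw [← hasFDerivWithinAt_univ]
    refine hasFDerivWithinAt_of_norm_le_rpow (C := D * C ^ (1 + α : ℝ)) (NNReal.coe_pos.2 hα)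
      fun y' _ => ?_
    have := hl (fun t => Φ t y) (fun t => Φ t y') (fun t => J y t (y' - y)) (fun _ => 0)
      (fun _ => 0) (C * ‖y' - y‖) 0 (by positivity) le_rfl (hΦ.hasDerivAt y)
      (fun t => by simpa using hΦ.hasDerivAt y' t)
      (fun t => by simpa using (hJ y t).clm_apply (hasDerivAt_const t (y' - y)))
      (fun t ht => hd y y' t ht) (fun _ _ => by simp) t le_rfl
    refine this.trans (le_of_eq ?_)
    rw [hΦ.zero, hΦ.zero, hJ0, Real.mul_rpow hC (norm_nonneg _)]
    simp [mul_assoc]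

theorem hasStrictFDerivAt_flow (hV : IsHolderFamily α V DV) {Φ : ℝ → F → F} (hΦ : IsFlow V Φ)
    {J : ℝ → F → F →L[ℝ] F} (hJc : Continuous fun p : ℝ × F => J p.1 p.2)
    (hJ : ∀ t y, HasFDerivAt (Φ t) (J t y) y) (p : ℝ × F) :
    HasStrictFDerivAt (fun p : ℝ × F => Φ p.1 p.2)
      ((ContinuousLinearMap.toSpanSingleton ℝ (V p.1 (Φ p.1 p.2))).coprod (J p.1 p.2)) p := by
  have hc : Continuous fun p : ℝ × F => V p.1 (Φ p.1 p.2) :=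
    hV.continuous.comp (continuous_fst.prodMk (hV.continuous_flow hΦ))
  exact hasStrictFDerivAt_uncurry_coprod (f := Φ)
    (f₁ := fun t y => ContinuousLinearMap.toSpanSingleton ℝ (V t (Φ t y))) (f₂ := J)
    (Eventually.of_forall fun q => (hΦ.hasDerivAt q.2 q.1).hasFDerivAt)
    (Eventually.of_forall fun q => hJ q.1 q.2)
    ((ContinuousLinearMap.toSpanSingletonCLE (𝕜 := ℝ) (E := F)).continuous.comp hc).continuousAt
    hJc.continuousAt

theorem contDiff_flow [CompleteSpace F] (hα : 0 < α) (hV : IsHolderFamily α V DV)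
    {Φ : ℝ → F → F} (hΦ : IsFlow V Φ) : ContDiff ℝ 1 fun p : ℝ × F => Φ p.1 p.2 := by
  obtain ⟨J, -, -, hJc, hJ⟩ := hV.exists_fderiv_flow hα hΦ
  refine contDiff_one_iff_hasFDerivAt.2
    ⟨_, ?_, fun p => (hV.hasStrictFDerivAt_flow hΦ hJc hJ p).hasFDerivAt⟩
  have hc : Continuous fun p : ℝ × F => V p.1 (Φ p.1 p.2) :=
    hV.continuous.comp (continuous_fst.prodMk (hV.continuous_flow hΦ))
  have hV' := (ContinuousLinearMap.toSpanSingletonCLE (𝕜 := ℝ) (E := F)).continuous.comp hc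
  have := (hV'.clm_comp (continuous_const (y := ContinuousLinearMap.fst ℝ ℝ F))).add
    (hJc.clm_comp (continuous_const (y := ContinuousLinearMap.snd ℝ ℝ F)))
  refine this.congr fun p => ?_
  ext <;> simp

/-- The space-time map `(t, y) ↦ (t, Φ t y)` of the flow is a `C¹` diffeomorphism; `I (t, x)` is the
point from which the flow reaches `x` at time `t`. -/
theorem exists_inverse_flow [FiniteDimensional ℝ F] (hα : 0 < α) (hV : IsHolderFamily α V DV)
    {Φ : ℝ → F → F} (hΦ : IsFlow V Φ) :
    ∃ I : ℝ × F → F, ContDiff ℝ 1 I ∧ (∀ t y, I (t, Φ t y) = y) ∧ ∀ t x, Φ t (I (t, x)) = x := by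
  have : CompleteSpace F := FiniteDimensional.complete ℝ F
  obtain ⟨J, hJ0, hJd, hJc, hJ⟩ := hV.exists_fderiv_flow hα hΦ
  have hinj : ∀ t y y', Φ t y = Φ t y' → y = y' := fun t y y' h => by
    have := hV.eq_of_hasDerivAt (hΦ.hasDerivAt y) (hΦ.hasDerivAt y') h 0
    rwa [hΦ.zero, hΦ.zero] at this
  have hsurj : ∀ t x, ∃ y, Φ t y = x := fun t x => by
    obtain ⟨X, hXt, hX⟩ :=
      exists_forall_hasDerivAt_of_initial_time hV.continuous hV.exists_lipschitzWith t x
    refine ⟨X 0, ?_⟩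
    rw [hV.eq_of_hasDerivAt (hΦ.hasDerivAt (X 0)) hX (hΦ.zero (X 0)) t, hXt]
  choose R hR using hsurj
  let e : ℝ × F ≃ ℝ × F :=
    { toFun := fun p => (p.1, Φ p.1 p.2)
      invFun := fun p => (p.1, R p.1 p.2)
      left_inv := fun p => Prod.ext rfl (hinj p.1 _ _ (hR _ _))
      right_inv := fun p => Prod.ext rfl (hR _ _) }
  have hJinj : ∀ t y k, J t y k = 0 → k = 0 := fun t y k h => by
    obtain ⟨K, hK, hb⟩ := hV.exists_bound |t|
    have := norm_le_of_norm_deriv_le (u := fun s => J s y k) (s := t) (t := 0) hK le_rfl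
      (fun r => by simpa using (hJd y r).clm_apply (hasDerivAt_const r k)) (fun r hr => by
        rw [add_zero]
        exact (DV r (Φ r y)).le_of_opNorm_le (hb r hr _).2.1 _) le_rfl (by simp)
    simpa [h, hJ0] using this
  let A : ℝ × F → ℝ × F →L[ℝ] ℝ × F := fun p => (ContinuousLinearMap.fst ℝ ℝ F).prod
    ((ContinuousLinearMap.toSpanSingleton ℝ (V p.1 (Φ p.1 p.2))).coprod (J p.1 p.2))
  have hA : ∀ p, HasStrictFDerivAt e (A p) p := fun p =>
    (ContinuousLinearMap.fst ℝ ℝ F).hasStrictFDerivAt.prodMk (hV.hasStrictFDerivAt_flow hΦ hJc hJ p)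
  have hAinj : ∀ p, Function.Injective (A p : ℝ × F →ₗ[ℝ] ℝ × F) := fun p => by
    rw [← LinearMap.ker_eq_bot, LinearMap.ker_eq_bot']
    rintro ⟨τ, k⟩ h
    obtain ⟨h1, h2⟩ := Prod.ext_iff.1 h
    have h1 : τ = 0 := h1
    subst h1
    have h2 : (0 : ℝ) • V p.1 (Φ p.1 p.2) + J p.1 p.2 k = 0 := h2
    rw [zero_smul, zero_add] at h2
    rw [hJinj _ _ _ h2]
    rfl
  let B : ℝ × F → (ℝ × F) ≃L[ℝ] ℝ × F := fun p =>
    (LinearEquiv.ofInjectiveEndo _ (hAinj p)).toContinuousLinearEquiv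
  have hB : ∀ p, HasStrictFDerivAt e (B p : ℝ × F →L[ℝ] ℝ × F) p := fun p => by
    have : (B p : ℝ × F →L[ℝ] ℝ × F) = A p := rfl
    rw [this]
    exact hA p
  have hec : ContDiff ℝ 1 e := contDiff_fst.prodMk (hV.contDiff_flow hα hΦ)
  let H : ℝ × F ≃ₜ ℝ × F :=
    e.toHomeomorphOfContinuousOpen hec.continuous (isOpenMap_of_hasStrictFDerivAt_equiv hB)
  have hH : ContDiff ℝ 1 H.symm := H.contDiff_symm (fun p => (hB p).hasFDerivAt) hec
  exact ⟨fun p => (H.symm p).2, contDiff_snd.comp hH, fun t y => hinj t _ _ (hR _ _),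
    fun t x => hR _ _⟩

end Flow

end IsHolderFamily

/-! ### Hölder families given by the coefficients, and their characteristics -/

section Coefficients

variable {E G : Type*} [NormedAddCommGroup E] [NormedSpace ℝ E] [NormedAddCommGroup G]
  [NormedSpace ℝ G] {α : ℝ≥0}

namespace HolderC1

theorem norm_fderiv_le (f : HolderC1 α E G) (x : E) : ‖fderiv ℝ f x‖ ≤ ‖f‖ := by
  have h₁ : 0 ≤ ⨆ x, ‖f x‖ := Real.iSup_nonneg fun _ => norm_nonneg _
  have h₂ : ‖fderiv ℝ f x‖ ≤ ⨆ x, ‖fderiv ℝ f x‖ := le_ciSup f.bddAbove_fderiv x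
  have h₃ : (0 : ℝ) ≤ nnHolderNorm α (fderiv ℝ f) := NNReal.coe_nonneg _
  rw [norm_def]
  linarith

theorem norm_fderiv_sub_le (f : HolderC1 α E G) (x y : E) :
    ‖fderiv ℝ f x - fderiv ℝ f y‖ ≤ ‖f‖ * ‖x - y‖ ^ (α : ℝ) := by
  have h₁ : 0 ≤ ⨆ x, ‖f x‖ := Real.iSup_nonneg fun _ => norm_nonneg _
  have h₂ : 0 ≤ ⨆ x, ‖fderiv ℝ f x‖ := Real.iSup_nonneg fun _ => norm_nonneg _
  have h := f.memHolder.holderWith.dist_le x y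
  rw [dist_eq_norm, dist_eq_norm] at h
  refine h.trans ?_
  gcongr
  rw [norm_def]
  linarith

theorem hasFDerivAt (f : HolderC1 α E G) (x : E) : HasFDerivAt f (fderiv ℝ f x) x :=
  (f.contDiff.differentiable one_ne_zero x).hasFDerivAt

theorem continuous_eval : Continuous fun p : HolderC1 α E G × E => p.1 p.2 :=
  continuous_prod_of_continuous_lipschitzWith _ 1 (fun f => f.contDiff.continuous) fun x =>
    LipschitzWith.of_dist_le_mul fun f g => by
      rw [dist_eq_norm, dist_eq_norm, NNReal.coe_one, one_mul]
      exact (f - g).norm_apply_le x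

theorem continuous_fderiv_eval : Continuous fun p : HolderC1 α E G × E => fderiv ℝ p.1 p.2 :=
  continuous_prod_of_continuous_lipschitzWith _ 1
    (fun f => f.contDiff.continuous_fderiv one_ne_zero) fun x =>
    LipschitzWith.of_dist_le_mul fun f g => by
      rw [dist_eq_norm, dist_eq_norm, NNReal.coe_one, one_mul]
      have h := congrFun (fderiv_coe_add (f - g) g) x
      rw [sub_add_cancel] at h
      rw [h, Pi.add_apply, add_sub_cancel_right]
      exact (f - g).norm_fderiv_le x

end HolderC1

/-- A continuous curve in `C^{1+α}` on `[0, ∞)`, frozen at its initial value for negative times. -/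
theorem isHolderFamily_of_continuous {b : ℝ≥0 → HolderC1 α E G} (hb : Continuous b) :
    IsHolderFamily α (fun t x => b t.toNNReal x) (fun t x => fderiv ℝ (b t.toNNReal) x) where
  continuous := HolderC1.continuous_eval.comp
    (((hb.comp continuous_real_toNNReal).comp continuous_fst).prodMk continuous_snd)
  hasFDerivAt t x := (b t.toNNReal).hasFDerivAt x
  continuous_deriv := HolderC1.continuous_fderiv_eval.comp
    (((hb.comp continuous_real_toNNReal).comp continuous_fst).prodMk continuous_snd)
  exists_bound T := by
    obtain ⟨K, hK⟩ := (isCompact_Icc (a := -T) (b := T)).exists_bound_of_continuousOn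
      (hb.comp continuous_real_toNNReal).continuousOn
    refine ⟨max K 0, le_max_right _ _, fun t ht x => ?_⟩
    have h : ‖b t.toNNReal‖ ≤ max K 0 := (hK t (abs_le.1 ht)).trans (le_max_left _ _)
    refine ⟨((b t.toNNReal).norm_apply_le x).trans h, ((b t.toNNReal).norm_fderiv_le x).trans h,
      fun y => ((b t.toNNReal).norm_fderiv_sub_le x y).trans ?_⟩
    gcongr

/-- A `C^{1+α}` function on `[0, ∞) × E`, frozen at its initial value for negative times. -/
theorem isHolderFamily_of_memHolderC1On (hα : 0 < α) {w : ℝ × E → G}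
    (hw : MemHolderC1On α w (Ici (0 : ℝ) ×ˢ (univ : Set E))) :
    IsHolderFamily α (fun t x => w (max t 0, x))
      (fun t x => (fderivWithin ℝ w (Ici (0 : ℝ) ×ˢ univ) (max t 0, x)).comp
        (ContinuousLinearMap.inr ℝ ℝ E)) := by
  obtain ⟨hc, ⟨C₁, h₁⟩, ⟨C₂, h₂⟩, C₃, h₃⟩ := hw
  have hmem : ∀ (t : ℝ) (x : E), (max t 0, x) ∈ Ici (0 : ℝ) ×ˢ (univ : Set E) := fun t x =>
    ⟨mem_Ici.2 (le_max_right t 0), mem_univ _⟩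
  have hinr : ∀ A : ℝ × E →L[ℝ] G, ‖A.comp (ContinuousLinearMap.inr ℝ ℝ E)‖ ≤ ‖A‖ := fun A =>
    (A.opNorm_comp_le _).trans
      (mul_le_of_le_one_right (norm_nonneg _) (ContinuousLinearMap.norm_inr_le_one ℝ ℝ E))
  refine ⟨?_, fun t x => ?_, ?_, fun T => ?_⟩
  · exact hc.continuousOn.comp_continuous (f := fun p : ℝ × E => (max p.1 0, p.2)) (by fun_prop)
      fun p => hmem _ _
  · have h := (hc.differentiableOn one_ne_zero _ (hmem t x)).hasFDerivWithinAt
    rw [← hasFDerivWithinAt_univ]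
    exact h.comp x (hasFDerivAt_prodMk_right (max t 0) x).hasFDerivWithinAt fun y _ => hmem t y
  · refine Continuous.clm_comp ?_ continuous_const
    exact (h₃.continuousOn hα).comp_continuous (f := fun p : ℝ × E => (max p.1 0, p.2))
      (by fun_prop) fun p => hmem _ _
  · refine ⟨max (max C₁ C₂) C₃, le_max_of_le_right C₃.2, fun t _ x => ⟨?_, ?_, fun y => ?_⟩⟩
    · exact (h₁ _ (hmem t x)).trans ((le_max_left _ _).trans (le_max_left _ _))
    · exact (hinr _).trans ((h₂ _ (hmem t x)).trans ((le_max_right _ _).trans (le_max_left _ _)))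
    · rw [← ContinuousLinearMap.sub_comp]
      refine (hinr _).trans ?_
      have h := h₃.dist_le (hmem t x) (hmem t y)
      rw [dist_eq_norm, dist_eq_norm, Prod.mk_sub_mk, sub_self, Prod.norm_mk, norm_zero,
        max_eq_right (norm_nonneg _)] at h
      refine h.trans ?_
      gcongr
      exact le_max_right _ _

end Coefficients

/-- The characteristics of `∂ₜ μ + div (v μ) = g μ`: the flow `Φ` of `v`, and the integral `W t y` of
`g` along the trajectory that starts at `y`. -/
structure IsCharacteristics {E : Type*} [NormedAddCommGroup E] [NormedSpace ℝ E] (v : ℝ → E → E)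
    (g : ℝ → E → ℝ) (Φ : ℝ → E → E) (W : ℝ → E → ℝ) : Prop where
  flow : IsFlow v Φ
  weight_zero : ∀ y, W 0 y = 0
  hasDerivAt_weight : ∀ y t, HasDerivAt (fun s => W s y) (g t (Φ t y)) t
  contDiff_flow : ContDiff ℝ 1 fun p : ℝ × E => Φ p.1 p.2
  contDiff_weight : ContDiff ℝ 1 fun p : ℝ × E => W p.1 p.2

section Characteristics

variable {E : Type*} [NormedAddCommGroup E] [NormedSpace ℝ E] {α : ℝ≥0} {v : ℝ → E → E}
  {Dv : ℝ → E → E →L[ℝ] E} {g : ℝ → E → ℝ} {Dg : ℝ → E → E →L[ℝ] ℝ} {Φ : ℝ → E → E} {W : ℝ → E → ℝ}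

/-- The field on `E × ℝ` whose flow transports the weight along with the position. -/
theorem IsHolderFamily.augmented (hv : IsHolderFamily α v Dv) (hg : IsHolderFamily α g Dg) :
    IsHolderFamily α (fun t (p : E × ℝ) => (v t p.1, g t p.1))
      (fun t p => ((Dv t p.1).prod (Dg t p.1)).comp (ContinuousLinearMap.fst ℝ E ℝ)) :=
  (hv.prodMk hg).comp_fst

theorem exists_isCharacteristics [CompleteSpace E] (hα : 0 < α) (hv : IsHolderFamily α v Dv)
    (hg : IsHolderFamily α g Dg) : ∃ Φ W, IsCharacteristics v g Φ W := by
  obtain ⟨Ψ, hΨ⟩ := (hv.augmented hg).exists_isFlow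
  have hc := (hv.augmented hg).contDiff_flow hα hΨ
  have hc0 : ContDiff ℝ 1 fun p : ℝ × E => Ψ p.1 (p.2, 0) :=
    hc.comp (f := fun p : ℝ × E => (p.1, p.2, (0 : ℝ))) (by fun_prop)
  exact ⟨fun t y => (Ψ t (y, 0)).1, fun t y => (Ψ t (y, 0)).2,
    ⟨fun y => by simp only [hΨ.zero], fun y t => (hΨ.hasDerivAt (y, 0) t).fst⟩,
    fun y => by simp only [hΨ.zero], fun y t => (hΨ.hasDerivAt (y, 0) t).snd,
    contDiff_fst.comp hc0, contDiff_snd.comp hc0⟩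

namespace IsCharacteristics

theorem isFlow_augmented (h : IsCharacteristics v g Φ W) :
    IsFlow (fun t (p : E × ℝ) => (v t p.1, g t p.1)) fun t p => (Φ t p.1, p.2 + W t p.1) where
  zero p := by simp [h.flow.zero, h.weight_zero]
  hasDerivAt p t := (h.flow.hasDerivAt p.1 t).prodMk ((h.hasDerivAt_weight p.1 t).const_add p.2)

/-- The inverse of the characteristic flow: `I₁ (t, x)` is the starting point of the trajectory
that reaches `x` at time `t`, and `- I₂ (t, x)` is the weight accumulated along it. -/
theorem exists_inverse [FiniteDimensional ℝ E] (hα : 0 < α) (hv : IsHolderFamily α v Dv)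
    (hg : IsHolderFamily α g Dg) (h : IsCharacteristics v g Φ W) :
    ∃ (I₁ : ℝ × E → E) (I₂ : ℝ × E → ℝ), ContDiff ℝ 1 I₁ ∧ ContDiff ℝ 1 I₂ ∧
      (∀ t y, I₁ (t, Φ t y) = y) ∧ (∀ t y, I₂ (t, Φ t y) = -W t y) ∧
      ∀ t x, Φ t (I₁ (t, x)) = x := by
  obtain ⟨I, hI, h1, h2⟩ := (hv.augmented hg).exists_inverse_flow hα h.isFlow_augmented
  have h3 : ∀ t y, I (t, Φ t y, 0) = (y, -W t y) := fun t y => by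
    simpa using h1 t (y, -W t y)
  have hc : ContDiff ℝ 1 fun p : ℝ × E => I (p.1, p.2, 0) :=
    hI.comp (f := fun p : ℝ × E => (p.1, p.2, (0 : ℝ))) (by fun_prop)
  exact ⟨fun p => (I (p.1, p.2, 0)).1, fun p => (I (p.1, p.2, 0)).2, contDiff_fst.comp hc,
    contDiff_snd.comp hc, fun t y => congrArg Prod.fst (h3 t y),
    fun t y => congrArg Prod.snd (h3 t y), fun t x => congrArg Prod.fst (h2 t (x, 0))⟩

theorem exists_abs_weight_le (hg : IsHolderFamily α g Dg) (h : IsCharacteristics v g Φ W) (T : ℝ) :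
    ∃ M : ℝ, ∀ t, |t| ≤ T → ∀ y, |W t y| ≤ M := by
  obtain ⟨K, hK, hb⟩ := hg.exists_bound T
  refine ⟨K * Real.exp ((0 + 1) * (2 * T)), fun t ht y => ?_⟩
  have := norm_le_of_norm_deriv_le le_rfl hK (h.hasDerivAt_weight y)
    (fun r hr => by simpa using (hb r hr _).1) (s := 0) (by simpa using (abs_nonneg t).trans ht) ht
  simpa [h.weight_zero] using this

end IsCharacteristics

end Characteristics

/-! ### Existence: transport of the initial measure along the characteristics -/

theorem continuous_integral_of_locally_bounded {E : Type*} [NormedAddCommGroup E] [MeasurableSpace E]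
    [BorelSpace E] [SecondCountableTopology E] {ν : Measure E}
    [IsFiniteMeasure ν] {f : ℝ → E → ℝ} (hf : Continuous fun p : ℝ × E => f p.1 p.2)
    (hb : ∀ T : ℝ, ∃ C : ℝ, ∀ t, |t| ≤ T → ∀ y, |f t y| ≤ C) :
    Continuous fun t => ∫ y, f t y ∂ν := by
  rw [continuous_iff_continuousAt]
  intro t₀
  obtain ⟨C, hC⟩ := hb (|t₀| + 1)
  refine continuousAt_of_dominated (bound := fun _ => C) (Eventually.of_forall fun t => ?_) ?_
    (integrable_const C) (Eventually.of_forall fun y => ?_)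
  · exact (hf.comp (continuous_const.prodMk continuous_id)).aestronglyMeasurable
  · have hev : ∀ᶠ t in 𝓝 t₀, |t| < |t₀| + 1 :=
      continuous_abs.continuousAt.eventually_lt continuousAt_const (by simp)
    filter_upwards [hev] with t ht
    exact Eventually.of_forall fun y => hC t ht.le y
  · exact (hf.comp (continuous_id.prodMk continuous_const)).continuousAt

section Representation

variable {E : Type*} [NormedAddCommGroup E] [NormedSpace ℝ E]
  {α : ℝ≥0} {v : ℝ → E → E} {Dv : ℝ → E → E →L[ℝ] E} {g : ℝ → E → ℝ} {Dg : ℝ → E → E →L[ℝ] ℝ}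
  {Φ : ℝ → E → E} {W : ℝ → E → ℝ}

theorem IsCharacteristics.exists_abs_mul_exp_weight_le (hg : IsHolderFamily α g Dg)
    (h : IsCharacteristics v g Φ W) {f : ℝ → E → ℝ}
    (hb : ∀ T : ℝ, ∃ C : ℝ, ∀ t, |t| ≤ T → ∀ x, |f t x| ≤ C) (T : ℝ) :
    ∃ C : ℝ, ∀ t, |t| ≤ T → ∀ y, |f t (Φ t y) * Real.exp (W t y)| ≤ C := by
  obtain ⟨M, hM⟩ := h.exists_abs_weight_le hg T
  obtain ⟨C, hC⟩ := hb T
  refine ⟨C * Real.exp M, fun t ht y => ?_⟩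
  rw [abs_mul, Real.abs_exp]
  have h1 := hC t ht (Φ t y)
  have h2 := Real.exp_le_exp.2 ((le_abs_self _).trans (hM t ht y))
  exact mul_le_mul h1 h2 (Real.exp_pos _).le ((abs_nonneg _).trans h1)

theorem IsCharacteristics.continuous_mul_exp_weight (h : IsCharacteristics v g Φ W) {f : ℝ → E → ℝ}
    (hf : Continuous fun p : ℝ × E => f p.1 p.2) :
    Continuous fun p : ℝ × E => f p.1 (Φ p.1 p.2) * Real.exp (W p.1 p.2) :=
  (hf.comp (continuous_fst.prodMk h.contDiff_flow.continuous)).mul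
    (Real.continuous_exp.comp h.contDiff_weight.continuous)

theorem IsFlow.hasDerivAt_comp (h : IsFlow v Φ) {φ : ℝ × E → ℝ} (hφ : ContDiff ℝ 1 φ) (y : E)
    (t : ℝ) : HasDerivAt (fun s => φ (s, Φ s y))
      (fderiv ℝ φ (t, Φ t y) (1, 0) + fderiv ℝ φ (t, Φ t y) (0, v t (Φ t y))) t := by
  have h1 := ((hφ.differentiable one_ne_zero (t, Φ t y)).hasFDerivAt).comp_hasDerivAt t
    ((hasDerivAt_id t).prodMk (h.hasDerivAt y t))
  rw [← map_add, Prod.mk_add_mk, add_zero, zero_add]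
  exact h1

variable [MeasurableSpace E] [BorelSpace E]

/-- `μ t` is the image under `Φ t` of the measure with density `exp (W t)` with respect to `μ₀`,
expressed through the integrals of continuous functions. -/
def IsTransported (Φ : ℝ → E → E) (W : ℝ → E → ℝ) (μ₀ : Measure E) (μ : ℝ≥0 → FiniteMeasure E) :
    Prop :=
  ∀ (t : ℝ≥0) (f : E → ℝ), Continuous f →
    ∫ x, f x ∂(μ t : Measure E) = ∫ y, f (Φ t y) * Real.exp (W t y) ∂μ₀

theorem IsCharacteristics.exists_isTransported (hg : IsHolderFamily α g Dg)
    (h : IsCharacteristics v g Φ W) (μ₀ : Measure E) [IsFiniteMeasure μ₀] :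
    ∃ μ, IsTransported Φ W μ₀ μ := by
  have hW : ∀ t : ℝ, Continuous (W t) := fun t =>
    h.contDiff_weight.continuous.comp (continuous_const.prodMk continuous_id)
  have hΦ : ∀ t : ℝ, Continuous (Φ t) := fun t =>
    h.contDiff_flow.continuous.comp (continuous_const.prodMk continuous_id)
  have hd : ∀ t : ℝ, Measurable fun y => (Real.exp (W t y)).toNNReal := fun t =>
    (continuous_real_toNNReal.comp (Real.continuous_exp.comp (hW t))).measurable
  have hfin : ∀ t : ℝ, IsFiniteMeasure
      ((μ₀.withDensity fun y => ((Real.exp (W t y)).toNNReal : ENNReal)).map (Φ t)) := fun t => by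
    obtain ⟨M, hM⟩ := h.exists_abs_weight_le hg |t|
    have : IsFiniteMeasure (μ₀.withDensity fun y => ((Real.exp (W t y)).toNNReal : ENNReal)) := by
      refine isFiniteMeasure_withDensity_ofReal
        (Integrable.of_bound (C := Real.exp M) (Real.continuous_exp.comp
          (hW t)).aestronglyMeasurable (Eventually.of_forall fun y => ?_)).2
      rw [Function.comp_apply, Real.norm_of_nonneg (Real.exp_pos _).le]
      exact Real.exp_le_exp.2 ((le_abs_self _).trans (hM t le_rfl y))
    infer_instance
  refine ⟨fun t => ⟨_, hfin t⟩, fun t f hf => ?_⟩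
  simp only [FiniteMeasure.toMeasure_mk]
  rw [integral_map (hΦ t).aemeasurable hf.aestronglyMeasurable,
    integral_withDensity_eq_integral_smul (hd t)]
  refine integral_congr_ae (Eventually.of_forall fun y => ?_)
  simp only [NNReal.smul_def, smul_eq_mul, Real.coe_toNNReal _ (Real.exp_pos _).le]
  ring

/-- The transported measures depend narrowly continuously on time. -/
theorem IsTransported.continuous [SecondCountableTopology E] (hg : IsHolderFamily α g Dg)
    (h : IsCharacteristics v g Φ W) {μ₀ : Measure E} [IsFiniteMeasure μ₀]
    {μ : ℝ≥0 → FiniteMeasure E} (hμ : IsTransported Φ W μ₀ μ) : Continuous μ := by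
  rw [FiniteMeasure.continuous_iff_forall_continuous_integral]
  intro f
  have key := continuous_integral_of_locally_bounded (ν := μ₀)
    (h.continuous_mul_exp_weight (f := fun _ x => f x) (f.continuous.comp continuous_snd))
    (h.exists_abs_mul_exp_weight_le hg fun _ => ⟨‖f‖, fun _ _ x => f.norm_coe_le_norm x⟩)
  have e : (fun t : ℝ≥0 => ∫ x, f x ∂(μ t : Measure E))
      = fun t : ℝ≥0 => ∫ y, f (Φ t y) * Real.exp (W t y) ∂μ₀ := funext fun t => hμ t f f.continuous
  rw [e]
  exact key.comp NNReal.continuous_coe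

end Representation

theorem exists_abs_le_of_hasCompactSupport {X : Type*} [TopologicalSpace X] {F : Type*}
    [NormedAddCommGroup F] {f : X → F} (hf : Continuous f) (hs : HasCompactSupport f) :
    ∃ C : ℝ, 0 ≤ C ∧ ∀ x, ‖f x‖ ≤ C := by
  obtain ⟨C, hC⟩ := hs.exists_bound_of_continuous hf
  exact ⟨max C 0, le_max_right _ _, fun x => (hC x).trans (le_max_left _ _)⟩

section Existence

variable {d : ℕ} {α : ℝ≥0} {u : ℝ≥0 → EuclideanSpace ℝ (Fin d) → EuclideanSpace ℝ (Fin d)}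
  {Dv : ℝ → EuclideanSpace ℝ (Fin d) → EuclideanSpace ℝ (Fin d) →L[ℝ] EuclideanSpace ℝ (Fin d)}
  {w : ℝ × EuclideanSpace ℝ (Fin d) → ℝ}
  {Dg : ℝ → EuclideanSpace ℝ (Fin d) → EuclideanSpace ℝ (Fin d) →L[ℝ] ℝ}
  {Φ : ℝ → EuclideanSpace ℝ (Fin d) → EuclideanSpace ℝ (Fin d)}
  {W : ℝ → EuclideanSpace ℝ (Fin d) → ℝ} {μ₀ : ProbabilityMeasure (EuclideanSpace ℝ (Fin d))}

/-- Along each characteristic, `φ exp(W)` has the derivative `(∂ₜ φ + v · ∇φ + w φ) exp(W)`;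
integrating in time and then with respect to `μ₀` gives the weak formulation. -/
theorem IsTransported.isWeakSolution (hv : IsHolderFamily α (fun t x => u t.toNNReal x) Dv)
    (hg : IsHolderFamily α (fun t x => w (max t 0, x)) Dg)
    (h : IsCharacteristics (fun t x => u t.toNNReal x) (fun t x => w (max t 0, x)) Φ W)
    {μ : ℝ≥0 → FiniteMeasure (EuclideanSpace ℝ (Fin d))} (hμ : IsTransported Φ W (μ₀ : Measure _) μ) :
    IsWeakSolution u w μ₀ μ := by
  refine ⟨hμ.continuous hg h, fun φ hφ hs => ?_⟩
  have hφ' : Continuous (fderiv ℝ φ) := hφ.continuous_fderiv one_ne_zero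
  obtain ⟨C₀, hC₀, hb₀⟩ := exists_abs_le_of_hasCompactSupport hφ.continuous hs
  obtain ⟨C₁, hC₁, hb₁⟩ := exists_abs_le_of_hasCompactSupport hφ' (hs.fderiv ℝ)
  obtain ⟨R, hR0, hR⟩ : ∃ R : ℝ, 0 < R ∧ ∀ t x, R ≤ t → φ (t, x) = 0 ∧ fderiv ℝ φ (t, x) = 0 := by
    obtain ⟨R, hR0, hR⟩ := hs.isCompact.isBounded.exists_pos_norm_lt
    refine ⟨R, hR0, fun t x ht => ?_⟩
    have : (t, x) ∉ tsupport φ := fun hmem => by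
      have h1 := hR _ hmem
      have h2 := (le_abs_self t).trans (norm_fst_le (t, x))
      linarith
    exact ⟨image_eq_zero_of_notMem_tsupport this,
      image_eq_zero_of_notMem_tsupport fun h' => this (tsupport_fderiv_subset ℝ h')⟩
  let a : ℝ → EuclideanSpace ℝ (Fin d) → ℝ := fun t x =>
    fderiv ℝ φ (t, x) (1, 0) + fderiv ℝ φ (t, x) (0, u t.toNNReal x)
  let b : ℝ → EuclideanSpace ℝ (Fin d) → ℝ := fun t x => w (max t 0, x) * φ (t, x)
  have hac : Continuous fun p : ℝ × EuclideanSpace ℝ (Fin d) => a p.1 p.2 := by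
    refine (hφ'.clm_apply continuous_const).add (hφ'.clm_apply ?_)
    exact continuous_const.prodMk hv.continuous
  have hbc : Continuous fun p : ℝ × EuclideanSpace ℝ (Fin d) => b p.1 p.2 :=
    hg.continuous.mul hφ.continuous
  have hab : ∀ T : ℝ, ∃ C : ℝ, ∀ t, |t| ≤ T → ∀ x, |a t x| ≤ C := fun T => by
    obtain ⟨K, hK, hb⟩ := hv.exists_bound T
    refine ⟨C₁ * 1 + C₁ * K, fun t ht x => (abs_add_le _ _).trans (add_le_add ?_ ?_)⟩
    · refine ((fderiv ℝ φ (t, x)).le_of_opNorm_le (hb₁ _) _).trans ?_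
      simp
    · refine ((fderiv ℝ φ (t, x)).le_of_opNorm_le (hb₁ _) _).trans ?_
      rw [Prod.norm_mk, norm_zero, max_eq_right (norm_nonneg _)]
      gcongr
      exact (hb t ht x).1
  have hbb : ∀ T : ℝ, ∃ C : ℝ, ∀ t, |t| ≤ T → ∀ x, |b t x| ≤ C := fun T => by
    obtain ⟨K, hK, hb⟩ := hg.exists_bound T
    refine ⟨K * C₀, fun t ht x => ?_⟩
    rw [abs_mul]
    exact mul_le_mul (hb t ht x).1 (hb₀ _) (abs_nonneg _) hK
  let A : ℝ → ℝ := fun t => ∫ y, a t (Φ t y) * Real.exp (W t y) ∂(μ₀ : Measure _)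
  let B : ℝ → ℝ := fun t => ∫ y, b t (Φ t y) * Real.exp (W t y) ∂(μ₀ : Measure _)
  have hA : Continuous A := continuous_integral_of_locally_bounded
    (h.continuous_mul_exp_weight hac) (h.exists_abs_mul_exp_weight_le hg hab)
  have hB : Continuous B := continuous_integral_of_locally_bounded
    (h.continuous_mul_exp_weight hbc) (h.exists_abs_mul_exp_weight_le hg hbb)
  have toIoc : ∀ f : ℝ → ℝ, (∀ t, R ≤ t → f t = 0) →
      ∫ t in Ioi (0 : ℝ), f t = ∫ t in (0 : ℝ)..R, f t := fun f hf => by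
    rw [intervalIntegral.integral_of_le hR0.le]
    refine setIntegral_eq_of_subset_of_forall_sdiff_eq_zero measurableSet_Ioi Ioc_subset_Ioi_self
      fun t ht => hf t ?_
    by_contra hlt
    exact ht.2 ⟨ht.1, (not_le.1 hlt).le⟩
  have eA : ∫ t in Ioi (0 : ℝ), ∫ x, (fderiv ℝ φ (t, x) (1, 0)
      + fderiv ℝ φ (t, x) (0, u t.toNNReal x)) ∂(μ t.toNNReal : Measure _)
      = ∫ t in (0 : ℝ)..R, A t := by
    rw [← toIoc A fun t ht => by simp [A, a, (hR t _ ht).2]]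
    refine setIntegral_congr_fun measurableSet_Ioi fun t ht => ?_
    have := hμ t.toNNReal (a t) (hac.comp (continuous_const.prodMk continuous_id))
    rw [Real.coe_toNNReal _ (le_of_lt ht)] at this
    exact this
  have eB : ∫ t in Ioi (0 : ℝ), ∫ x, w (t, x) * φ (t, x) ∂(μ t.toNNReal : Measure _)
      = ∫ t in (0 : ℝ)..R, B t := by
    rw [← toIoc B fun t ht => by simp [B, b, (hR t _ ht).1]]
    refine setIntegral_congr_fun measurableSet_Ioi fun t ht => ?_
    have := hμ t.toNNReal (b t) (hbc.comp (continuous_const.prodMk continuous_id))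
    rw [Real.coe_toNNReal _ (le_of_lt ht)] at this
    simp only [b, max_eq_left (le_of_lt (mem_Ioi.1 ht))] at this
    simp only [B, b, max_eq_left (le_of_lt (mem_Ioi.1 ht))]
    exact this
  have hint : ∀ f : ℝ → EuclideanSpace ℝ (Fin d) → ℝ,
      (Continuous fun p : ℝ × EuclideanSpace ℝ (Fin d) => f p.1 p.2) →
      (∀ T : ℝ, ∃ C : ℝ, ∀ t, |t| ≤ T → ∀ x, |f t x| ≤ C) →
      Integrable (Function.uncurry fun t y => f t (Φ t y) * Real.exp (W t y))
        ((volume.restrict (uIoc 0 R)).prod (μ₀ : Measure _)) := fun f hf hfb => by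
    obtain ⟨C, hC⟩ := h.exists_abs_mul_exp_weight_le hg hfb R
    have : IsFiniteMeasure (volume.restrict (uIoc 0 R)) := ⟨by simp [uIoc_of_le hR0.le]⟩
    refine Integrable.of_bound (C := C)
      (h.continuous_mul_exp_weight hf).aestronglyMeasurable ?_
    have : ∀ᵐ p ∂(volume.restrict (uIoc 0 R)).prod
        (μ₀ : Measure (EuclideanSpace ℝ (Fin d))), p.1 ∈ uIoc 0 R :=
      Measure.quasiMeasurePreserving_fst.ae (ae_restrict_mem measurableSet_uIoc)
    filter_upwards [this] with p hp
    rw [uIoc_of_le hR0.le] at hp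
    exact hC p.1 (abs_le.2 ⟨by linarith [hp.1], hp.2⟩) p.2
  have eAB : (∫ t in (0 : ℝ)..R, A t) + ∫ t in (0 : ℝ)..R, B t
      = - ∫ x, φ (0, x) ∂(μ₀ : Measure (EuclideanSpace ℝ (Fin d))) := by
    simp only [A, B]
    rw [intervalIntegral_integral_swap (hint a hac hab),
      intervalIntegral_integral_swap (hint b hbc hbb),
      ← integral_add, ← integral_neg]
    rotate_left
    · simp only [intervalIntegral.integral_of_le hR0.le, ← uIoc_of_le hR0.le]
      exact (hint a hac hab).integral_prod_right
    · simp only [intervalIntegral.integral_of_le hR0.le, ← uIoc_of_le hR0.le]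
      exact (hint b hbc hbb).integral_prod_right
    refine integral_congr_ae (Eventually.of_forall fun y => ?_)
    simp only
    have hca : Continuous fun t => a t (Φ t y) * Real.exp (W t y) :=
      (h.continuous_mul_exp_weight hac).comp (continuous_id.prodMk continuous_const)
    have hcb : Continuous fun t => b t (Φ t y) * Real.exp (W t y) :=
      (h.continuous_mul_exp_weight hbc).comp (continuous_id.prodMk continuous_const)
    rw [← intervalIntegral.integral_add (hca.intervalIntegrable _ _) (hcb.intervalIntegrable _ _)]
    have hd : ∀ t ∈ uIcc (0 : ℝ) R, HasDerivAt (fun t => φ (t, Φ t y) * Real.exp (W t y))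
        (a t (Φ t y) * Real.exp (W t y) + b t (Φ t y) * Real.exp (W t y)) t := fun t _ => by
      convert! (h.flow.hasDerivAt_comp hφ y t).mul (h.hasDerivAt_weight y t).exp using 1
      simp only [b]
      ring
    rw [intervalIntegral.integral_eq_sub_of_hasDerivAt hd
      ((hca.add hcb).intervalIntegrable _ _), (hR R _ le_rfl).1, h.flow.zero, h.weight_zero]
    simp
  rw [eA, eB]
  linarith

end Existence

/-! ### Uniqueness: testing with functions that are constant along the characteristics -/

section Auxiliary

/-- Finite measures are determined by their integrals of compactly supported `C¹` functions: the
indicator of a bounded open set `U` is the limit of `1 - (1 - f)ⁿ` for any smooth `f` with values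
in `[0, 1]` whose support is `U`. -/
theorem measure_eq_of_forall_integral_contDiff {E : Type*} [NormedAddCommGroup E] [NormedSpace ℝ E]
    [FiniteDimensional ℝ E] [MeasurableSpace E] [BorelSpace E] {μ ν : Measure E}
    [IsFiniteMeasure μ] [IsFiniteMeasure ν]
    (h : ∀ f : E → ℝ, ContDiff ℝ 1 f → HasCompactSupport f → ∫ x, f x ∂μ = ∫ x, f x ∂ν) :
    μ = ν := by
  have : ProperSpace E := FiniteDimensional.proper ℝ E
  refine Measure.OuterRegular.ext_isOpen_isBounded fun U hU hUb => ?_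
  obtain ⟨f, hfU, hf, hf01⟩ := hU.exists_contDiff_support_eq (n := 1)
  have hr : ∀ x, 0 ≤ f x ∧ f x ≤ 1 := fun x => hf01 (mem_range_self x)
  let F : ℕ → E → ℝ := fun n x => 1 - (1 - f x) ^ n
  have hFc : ∀ n, ContDiff ℝ 1 (F n) := fun n => contDiff_const.sub ((contDiff_const.sub hf).pow n)
  have hF0 : ∀ n x, x ∉ U → F n x = 0 := fun n x hx => by
    have : f x = 0 := by
      rwa [← hfU, Function.mem_support, not_not] at hx
    simp [F, this]
  have hFs : ∀ n, HasCompactSupport (F n) := fun n =>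
    HasCompactSupport.intro hUb.isCompact_closure fun x hx => hF0 n x fun hx' =>
      hx (subset_closure hx')
  have hlim : ∀ ρ : Measure E, IsFiniteMeasure ρ →
      Tendsto (fun n => ∫ x, F n x ∂ρ) atTop (𝓝 (ρ.real U)) := fun ρ _ => by
    rw [← integral_indicator_one hU.measurableSet]
    refine tendsto_integral_of_dominated_convergence (fun _ => (1 : ℝ))
      (fun n => (hFc n).continuous.aestronglyMeasurable) (integrable_const _)
      (fun n => Eventually.of_forall fun x => ?_) (Eventually.of_forall fun x => ?_)
    · have h1 : 0 ≤ (1 - f x) ^ n := pow_nonneg (by linarith [(hr x).2]) n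
      have h2 : (1 - f x) ^ n ≤ 1 := pow_le_one₀ (by linarith [(hr x).2]) (by linarith [(hr x).1])
      rw [Real.norm_eq_abs, abs_le]
      constructor <;> simp only [F] <;> linarith
    · by_cases hx : x ∈ U
      · have hpos : 0 < f x := lt_of_le_of_ne (hr x).1 fun h0 => by
          rw [← hfU] at hx
          exact hx h0.symm
        have := (tendsto_pow_atTop_nhds_zero_of_lt_one (r := 1 - f x) (by linarith [(hr x).2])
          (by linarith)).const_sub 1
        simpa [F, hx] using this
      · simp [hF0 _ x hx, hx]
  have := tendsto_nhds_unique (hlim μ inferInstance)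
    ((hlim ν inferInstance).congr fun n => (h (F n) (hFc n) (hFs n)).symm)
  rwa [measureReal_def, measureReal_def,
    ENNReal.toReal_eq_toReal_iff' (measure_ne_top _ _) (measure_ne_top _ _)] at this

/-- A continuous function on `[0, ∞)` with distributional derivative zero and initial value `c`
is constant. The test function is a primitive of `(m - c)` times a cutoff. -/
theorem eq_of_forall_integral_deriv_mul {m : ℝ → ℝ} (hm : Continuous m) {c : ℝ}
    (h : ∀ η : ℝ → ℝ, ContDiff ℝ 1 η → HasCompactSupport η →
      ∫ t in Ioi (0 : ℝ), deriv η t * m t = -(η 0 * c)) {t : ℝ} (ht : 0 ≤ t) : m t = c := by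
  set R := t + 1 with hR
  have hR0 : 0 < R := by positivity
  let g : ℝ → ℝ := fun s => (m s - c) * max 0 (R - s)
  have hg : Continuous g := by fun_prop
  have hgR : ∀ s, R ≤ s → g s = 0 := fun s hs => by
    simp only [g]
    rw [max_eq_left (by linarith), mul_zero]
  let P : ℝ → ℝ := fun s => ∫ r in R..s, g r
  have hP : ∀ s, HasDerivAt P (g s) s := fun s =>
    intervalIntegral.integral_hasDerivAt_right (hg.intervalIntegrable _ _)
      hg.stronglyMeasurable.stronglyMeasurableAtFilter hg.continuousAt
  have hPR : ∀ s, R ≤ s → P s = 0 := fun s hs => by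
    have : EqOn g (fun _ => 0) (uIcc R s) := fun r hr => hgR r (by
      rw [uIcc_of_le hs] at hr
      exact hr.1)
    simp only [P]
    rw [intervalIntegral.integral_congr this]
    simp
  have hPc : ContDiff ℝ 1 P := by
    rw [contDiff_one_iff_deriv]
    refine ⟨fun s => (hP s).differentiableAt, ?_⟩
    rwa [funext fun s => (hP s).deriv]
  -- Only the values on `[0, ∞)` matter, so that `P` may be cut off to the left of `0`.
  let η : ℝ → ℝ := fun s => Real.smoothTransition (s + 1) * P s
  have hη : ContDiff ℝ 1 η :=
    (Real.smoothTransition.contDiff.comp (contDiff_id.add contDiff_const)).mul hPc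
  have hηs : HasCompactSupport η := HasCompactSupport.intro (isCompact_Icc (a := -1) (b := R))
    fun s hs => by
      rw [mem_Icc, not_and_or, not_le, not_le] at hs
      rcases hs with hs | hs
      · simp only [η]
        rw [Real.smoothTransition.zero_of_nonpos (by linarith), zero_mul]
      · simp only [η]
        rw [hPR s hs.le, mul_zero]
  have hηeq : ∀ s, 0 ≤ s → η s = P s := fun s hs => by
    simp only [η]
    rw [Real.smoothTransition.one_of_one_le (by linarith), one_mul]
  have hηd : ∀ s, 0 < s → deriv η s = g s := fun s hs => by
    refine HasDerivAt.deriv ((hP s).congr_of_eventuallyEq ?_)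
    filter_upwards [Ioi_mem_nhds hs] with r hr
    exact hηeq r (le_of_lt hr)
  have h1 := h η hη hηs
  have h2 : ∫ s in Ioi (0 : ℝ), deriv η s * m s = ∫ s in (0 : ℝ)..R, g s * m s := by
    rw [intervalIntegral.integral_of_le hR0.le,
      setIntegral_congr_fun (g := fun s => g s * m s) measurableSet_Ioi fun s hs => by
        simp only [hηd s hs]]
    refine setIntegral_eq_of_subset_of_forall_sdiff_eq_zero measurableSet_Ioi Ioc_subset_Ioi_self
      fun s hs => ?_
    rw [hgR s, zero_mul]
    by_contra hlt
    exact hs.2 ⟨hs.1, (not_le.1 hlt).le⟩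
  rw [h2, hηeq 0 le_rfl] at h1
  have h3 : P 0 = -∫ s in (0 : ℝ)..R, g s := intervalIntegral.integral_symm _ _
  have h4 : ∫ s in (0 : ℝ)..R, g s * (m s - c) = 0 := by
    have e : ∀ s, g s * (m s - c) = g s * m s - g s * c := fun s => by ring
    simp only [e]
    have h5 : Continuous fun s => g s * m s := hg.mul hm
    have h6 : Continuous fun s => g s * c := hg.mul continuous_const
    rw [intervalIntegral.integral_sub (h5.intervalIntegrable _ _) (h6.intervalIntegrable _ _),
      intervalIntegral.integral_mul_const, h1, h3]
    ring
  by_contra hne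
  have h5 : 0 < ∫ s in (0 : ℝ)..R, g s * (m s - c) := by
    refine intervalIntegral.integral_pos hR0 (by fun_prop) (fun s _ => ?_)
      ⟨t, ⟨ht, by linarith⟩, ?_⟩
    · have : g s * (m s - c) = (m s - c) ^ 2 * max 0 (R - s) := by
        simp only [g]
        ring
      rw [this]
      positivity
    · have : g t * (m t - c) = (m t - c) ^ 2 := by
        simp only [g, hR]
        rw [add_sub_cancel_left, max_eq_right zero_le_one]
        ring
      rw [this]
      have := sub_ne_zero.2 hne
      positivity
  exact h5.ne' h4

/-- Time continuity of the integrals of a time-dependent function whose spatial supports lie,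
locally uniformly in time, in a compact set. -/
theorem continuous_integral_of_locally_compact_support {E : Type*} [TopologicalSpace E] [R1Space E]
    [MeasurableSpace E] [BorelSpace E] {μ : ℝ → FiniteMeasure E} (hμ : Continuous μ)
    {f : ℝ → E → ℝ} (hf : Continuous fun p : ℝ × E => f p.1 p.2)
    (hs : ∀ T : ℝ, ∃ k : Set E, IsCompact k ∧ ∀ t, |t| ≤ T → ∀ x, x ∉ k → f t x = 0) :
    Continuous fun t => ∫ x, f t x ∂(μ t : Measure E) := by
  have hft : ∀ t, Continuous (f t) := fun t => hf.comp (continuous_const.prodMk continuous_id)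
  have hcs : ∀ t, HasCompactSupport (f t) := fun t => by
    obtain ⟨k, hk, h⟩ := hs |t|
    exact HasCompactSupport.intro hk (h t le_rfl)
  have hi : ∀ s t, Integrable (f s) (μ t : Measure E) := fun s t =>
    (hft s).integrable_of_hasCompactSupport (hcs s)
  rw [continuous_iff_continuousAt]
  intro t₀
  obtain ⟨C, hC, hb⟩ := exists_abs_le_of_hasCompactSupport (hft t₀) (hcs t₀)
  have h1 : Tendsto (fun t => ∫ x, f t₀ x ∂(μ t : Measure E)) (𝓝 t₀)
      (𝓝 (∫ x, f t₀ x ∂(μ t₀ : Measure E))) :=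
    FiniteMeasure.tendsto_iff_forall_integral_tendsto.1 hμ.continuousAt
      (BoundedContinuousFunction.ofNormedAddCommGroup (f t₀) (hft t₀) C hb)
  have h2 : Tendsto (fun t => ∫ x, (f t x - f t₀ x) ∂(μ t : Measure E)) (𝓝 t₀) (𝓝 0) := by
    rw [Metric.tendsto_nhds]
    intro ε hε
    obtain ⟨k, hk, hk0⟩ := hs (|t₀| + 1)
    set M : ℝ := (μ t₀).mass + 1
    have hM : 0 < M := by positivity
    obtain ⟨V, hV, hVk⟩ := hk.mem_uniformity_of_prod (f := f) (s := univ) (q := t₀)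
      hf.continuousOn (mem_univ _) (Metric.dist_mem_uniformity (ε := ε / M) (by positivity))
    rw [nhdsWithin_univ] at hV
    have hmass : ∀ᶠ t in 𝓝 t₀, ((μ t).mass : ℝ) < M :=
      (NNReal.continuous_coe.comp (FiniteMeasure.continuous_mass.comp hμ)).continuousAt.eventually_lt
        continuousAt_const (by simp [M])
    have hev : ∀ᶠ t in 𝓝 t₀, |t| < |t₀| + 1 :=
      continuous_abs.continuousAt.eventually_lt continuousAt_const (by simp)
    filter_upwards [hV, hmass, hev] with t ht hmt ht'
    rw [dist_zero_right]
    have h3 : ∀ x, ‖f t x - f t₀ x‖ ≤ ε / M := fun x => by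
      by_cases hx : x ∈ k
      · have := hVk t ht x hx
        rw [mem_ofPred_eq, dist_eq_norm] at this
        exact this.le
      · rw [hk0 t ht'.le x hx, hk0 t₀ (by simp) x hx, sub_zero, norm_zero]
        positivity
    refine (norm_integral_le_of_norm_le_const (Eventually.of_forall h3)).trans_lt ?_
    have h4 : (μ t : Measure E).real univ < M := hmt
    calc ε / M * (μ t : Measure E).real univ < ε / M * M := by gcongr
      _ = ε := by field_simp
  have h3 := h2.add h1
  rw [zero_add] at h3
  refine h3.congr fun t => ?_
  rw [integral_sub (hi t t) (hi t₀ t), sub_add_cancel]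

end Auxiliary

section Uniqueness

variable {d : ℕ} {α : ℝ≥0} {u : ℝ≥0 → EuclideanSpace ℝ (Fin d) → EuclideanSpace ℝ (Fin d)}
  {Dv : ℝ → EuclideanSpace ℝ (Fin d) → EuclideanSpace ℝ (Fin d) →L[ℝ] EuclideanSpace ℝ (Fin d)}
  {w : ℝ × EuclideanSpace ℝ (Fin d) → ℝ}
  {Dg : ℝ → EuclideanSpace ℝ (Fin d) → EuclideanSpace ℝ (Fin d) →L[ℝ] ℝ}
  {Φ : ℝ → EuclideanSpace ℝ (Fin d) → EuclideanSpace ℝ (Fin d)}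
  {W : ℝ → EuclideanSpace ℝ (Fin d) → ℝ} {μ₀ : ProbabilityMeasure (EuclideanSpace ℝ (Fin d))}
  {μ : ℝ≥0 → FiniteMeasure (EuclideanSpace ℝ (Fin d))}

/-- Pulling a weak solution back along the characteristics and undoing the weight gives the initial
measure at all times: the function `η(t) ζ(I₁(t, x)) exp(I₂(t, x))` is an admissible test function,
and in the weak formulation only the term with `η'` survives. -/
theorem IsWeakSolution.integral_comp_inverse (hg : IsHolderFamily α (fun t x => w (max t 0, x)) Dg)
    (h : IsCharacteristics (fun t x => u t.toNNReal x) (fun t x => w (max t 0, x)) Φ W)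
    (hμ : IsWeakSolution u w μ₀ μ) {I₁ : ℝ × EuclideanSpace ℝ (Fin d) → EuclideanSpace ℝ (Fin d)}
    {I₂ : ℝ × EuclideanSpace ℝ (Fin d) → ℝ} (hI₁ : ContDiff ℝ 1 I₁) (hI₂ : ContDiff ℝ 1 I₂)
    (h₁ : ∀ t y, I₁ (t, Φ t y) = y) (h₂ : ∀ t y, I₂ (t, Φ t y) = -W t y)
    (h₃ : ∀ t x, Φ t (I₁ (t, x)) = x) {ζ : EuclideanSpace ℝ (Fin d) → ℝ} (hζ : ContDiff ℝ 1 ζ)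
    (hζs : HasCompactSupport ζ) (t : ℝ≥0) :
    ∫ x, ζ (I₁ (t, x)) * Real.exp (I₂ (t, x)) ∂(μ t : Measure (EuclideanSpace ℝ (Fin d)))
      = ∫ x, ζ x ∂(μ₀ : Measure (EuclideanSpace ℝ (Fin d))) := by
  obtain ⟨hμc, hμw⟩ := hμ
  have hμc' : Continuous fun t : ℝ => μ t.toNNReal := hμc.comp continuous_real_toNNReal
  let ψ : ℝ → EuclideanSpace ℝ (Fin d) → ℝ := fun t x => ζ (I₁ (t, x)) * Real.exp (I₂ (t, x))
  have hψ : ContDiff ℝ 1 fun p : ℝ × EuclideanSpace ℝ (Fin d) => ψ p.1 p.2 :=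
    (hζ.comp hI₁).mul hI₂.exp
  have hψs : ∀ T : ℝ, ∃ k : Set (EuclideanSpace ℝ (Fin d)), IsCompact k ∧
      ∀ t, |t| ≤ T → ∀ x, x ∉ k → ψ t x = 0 := fun T => by
    refine ⟨(fun p : ℝ × EuclideanSpace ℝ (Fin d) => Φ p.1 p.2) '' (Icc (-T) T ×ˢ tsupport ζ),
      (isCompact_Icc.prod hζs).image h.contDiff_flow.continuous, fun t ht x hx => ?_⟩
    have : ζ (I₁ (t, x)) = 0 := image_eq_zero_of_notMem_tsupport fun hmem =>
      hx ⟨(t, I₁ (t, x)), ⟨abs_le.1 ht, hmem⟩, h₃ t x⟩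
    simp only [ψ, this, zero_mul]
  have hψΦ : ∀ t y, ψ t (Φ t y) = ζ y * Real.exp (-W t y) := fun t y => by
    simp only [ψ, h₁, h₂]
  have hψ0 : ∀ x, ψ 0 x = ζ x := fun x => by
    have := hψΦ 0 x
    rwa [h.flow.zero, h.weight_zero, neg_zero, Real.exp_zero, mul_one] at this
  let m : ℝ → ℝ := fun t => ∫ x, ψ t x ∂(μ t.toNNReal : Measure (EuclideanSpace ℝ (Fin d)))
  have hm : Continuous m :=
    continuous_integral_of_locally_compact_support hμc' hψ.continuous hψs
  have key : ∀ η : ℝ → ℝ, ContDiff ℝ 1 η → HasCompactSupport η →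
      ∫ t in Ioi (0 : ℝ), deriv η t * m t
        = -(η 0 * ∫ x, ζ x ∂(μ₀ : Measure (EuclideanSpace ℝ (Fin d)))) := fun η hη hηs => by
    have hη' : Continuous (deriv η) := hη.continuous_deriv le_rfl
    let φ : ℝ × EuclideanSpace ℝ (Fin d) → ℝ := fun p => η p.1 * ψ p.1 p.2
    have hφ : ContDiff ℝ 1 φ := (hη.comp contDiff_fst).mul hψ
    obtain ⟨T, hT⟩ := hηs.isCompact.isBounded.exists_norm_le
    obtain ⟨k, hk, hψk⟩ := hψs T
    have hηT : ∀ t, T < |t| → η t = 0 := fun t ht =>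
      image_eq_zero_of_notMem_tsupport fun hmem => not_lt.2 (hT t hmem) ht
    have hφs : HasCompactSupport φ := by
      refine HasCompactSupport.intro (K := Icc (-T) T ×ˢ k) (isCompact_Icc.prod hk) fun p hp => ?_
      simp only [φ]
      by_cases ht : |p.1| ≤ T
      · rw [hψk p.1 ht p.2 fun hx => hp ⟨abs_le.1 ht, hx⟩, mul_zero]
      · rw [hηT _ (not_le.1 ht), zero_mul]
    have hder : ∀ t x, fderiv ℝ φ (t, x) (1, 0) + fderiv ℝ φ (t, x) (0, u t.toNNReal x)
        = deriv η t * ψ t x - w (max t 0, x) * φ (t, x) := fun t x => by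
      obtain ⟨y, rfl⟩ : ∃ y, Φ t y = x := ⟨_, h₃ t x⟩
      refine (h.flow.hasDerivAt_comp hφ y t).unique ?_
      have e : (fun s => φ (s, Φ s y)) = fun s => η s * (ζ y * Real.exp (-W s y)) :=
        funext fun s => by simp only [φ, hψΦ]
      rw [e]
      convert! (hη.differentiable one_ne_zero t).hasDerivAt.mul
        (((h.hasDerivAt_weight y t).neg.exp).const_mul (ζ y)) using 1
      simp only [φ, hψΦ, Pi.neg_apply]
      ring
    have hwφ : Continuous fun p : ℝ × EuclideanSpace ℝ (Fin d) =>
        w (max p.1 0, p.2) * φ (p.1, p.2) := hg.continuous.mul hφ.continuous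
    have hwφs : ∀ S : ℝ, ∃ k : Set (EuclideanSpace ℝ (Fin d)), IsCompact k ∧
        ∀ t, |t| ≤ S → ∀ x, x ∉ k → w (max t 0, x) * φ (t, x) = 0 := fun S => by
      obtain ⟨k, hk, h⟩ := hψs S
      exact ⟨k, hk, fun t ht x hx => by simp only [φ, h t ht x hx, mul_zero]⟩
    let n : ℝ → ℝ := fun t => ∫ x, w (max t 0, x) * φ (t, x)
      ∂(μ t.toNNReal : Measure (EuclideanSpace ℝ (Fin d)))
    have hn : Continuous n := continuous_integral_of_locally_compact_support hμc' hwφ hwφs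
    have hns : HasCompactSupport n := HasCompactSupport.intro (isCompact_Icc (a := -T) (b := T))
      fun t ht => by
        have : η t = 0 := hηT t (not_le.1 fun h' => ht (abs_le.1 h'))
        simp only [n, φ, this, zero_mul, mul_zero, integral_zero]
    have hcs : ∀ {f : ℝ → EuclideanSpace ℝ (Fin d) → ℝ},
        (Continuous fun p : ℝ × EuclideanSpace ℝ (Fin d) => f p.1 p.2) →
        (∀ S : ℝ, ∃ k : Set (EuclideanSpace ℝ (Fin d)), IsCompact k ∧
          ∀ t, |t| ≤ S → ∀ x, x ∉ k → f t x = 0) → ∀ t,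
        Integrable (f t) (μ t.toNNReal : Measure (EuclideanSpace ℝ (Fin d))) := fun hf hfs t => by
      obtain ⟨k, hk, h⟩ := hfs |t|
      exact (hf.comp (continuous_const.prodMk continuous_id)).integrable_of_hasCompactSupport
        (HasCompactSupport.intro hk (h t le_rfl))
    have hw := hμw φ hφ hφs
    have e1 : ∀ t, ∫ x, (fderiv ℝ φ (t, x) (1, 0) + fderiv ℝ φ (t, x) (0, u t.toNNReal x))
        ∂(μ t.toNNReal : Measure (EuclideanSpace ℝ (Fin d))) = deriv η t * m t - n t := fun t => by
      simp only [hder]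
      rw [integral_sub ((hcs hψ.continuous hψs t).const_mul _) (hcs hwφ hwφs t),
        integral_const_mul]
    have e2 : ∫ t in Ioi (0 : ℝ), ∫ x, w (t, x) * φ (t, x)
        ∂(μ t.toNNReal : Measure (EuclideanSpace ℝ (Fin d))) = ∫ t in Ioi (0 : ℝ), n t := by
      refine setIntegral_congr_fun measurableSet_Ioi fun t ht => ?_
      simp only [n, max_eq_left (le_of_lt (mem_Ioi.1 ht))]
    have e3 : ∫ x, φ (0, x) ∂(μ₀ : Measure (EuclideanSpace ℝ (Fin d)))
        = η 0 * ∫ x, ζ x ∂(μ₀ : Measure (EuclideanSpace ℝ (Fin d))) := by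
      simp only [φ, hψ0, integral_const_mul]
    simp only [e1] at hw
    have hηm : Integrable fun t => deriv η t * m t :=
      (hη'.mul hm).integrable_of_hasCompactSupport hηs.deriv.mul_right
    rw [e2, e3, integral_sub hηm.integrableOn
      (hn.integrable_of_hasCompactSupport hns).integrableOn] at hw
    linarith
  have := eq_of_forall_integral_deriv_mul hm key t.2
  simpa only [m, NNReal.val_eq_coe, Real.toNNReal_coe] using this

/-- Every weak solution is the transport of the initial measure along the characteristics. -/
theorem IsWeakSolution.eq_of_isTransported (hα : 0 < α)
    (hv : IsHolderFamily α (fun t x => u t.toNNReal x) Dv)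
    (hg : IsHolderFamily α (fun t x => w (max t 0, x)) Dg)
    (h : IsCharacteristics (fun t x => u t.toNNReal x) (fun t x => w (max t 0, x)) Φ W)
    (hμ : IsWeakSolution u w μ₀ μ) {ν : ℝ≥0 → FiniteMeasure (EuclideanSpace ℝ (Fin d))}
    (hν : IsTransported Φ W (μ₀ : Measure (EuclideanSpace ℝ (Fin d))) ν) : μ = ν := by
  obtain ⟨I₁, I₂, hI₁, hI₂, h₁, h₂, h₃⟩ := h.exists_inverse hα hv hg
  funext t
  have hfin : ∀ ρ : FiniteMeasure (EuclideanSpace ℝ (Fin d)), IsFiniteMeasure ρ.1 := fun ρ => ρ.2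
  have := hfin (μ t)
  have := hfin (ν t)
  refine Subtype.ext (measure_eq_of_forall_integral_contDiff fun f hf hfs => ?_)
  have hΦt : ContDiff ℝ 1 (Φ t) := h.contDiff_flow.comp (contDiff_const.prodMk contDiff_id)
  have hWt : ContDiff ℝ 1 (W t) := h.contDiff_weight.comp (contDiff_const.prodMk contDiff_id)
  have hζs : HasCompactSupport fun y => f (Φ t y) * Real.exp (W t y) := by
    refine HasCompactSupport.intro (K := (fun x => I₁ (t, x)) '' tsupport f)
      (IsCompact.image hfs (hI₁.continuous.comp (continuous_const.prodMk continuous_id)))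
      fun y hy => ?_
    have : f (Φ t y) = 0 := image_eq_zero_of_notMem_tsupport fun hmem => hy ⟨_, hmem, h₁ t y⟩
    rw [this, zero_mul]
  have key := hμ.integral_comp_inverse hg h hI₁ hI₂ h₁ h₂ h₃
    ((hf.comp hΦt).mul hWt.exp) hζs t
  have e : ∀ x, f (Φ t (I₁ (t, x))) * Real.exp (W t (I₁ (t, x))) * Real.exp (I₂ (t, x)) = f x :=
    fun x => by
      have h4 := h₂ t (I₁ (t, x))
      rw [h₃] at h4
      rw [h4, h₃, mul_assoc, ← Real.exp_add, add_neg_cancel, Real.exp_zero, mul_one]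
  have e' : ∫ x, f x ∂(μ t : Measure (EuclideanSpace ℝ (Fin d)))
      = ∫ y, f (Φ t y) * Real.exp (W t y) ∂(μ₀ : Measure (EuclideanSpace ℝ (Fin d))) := by
    refine (integral_congr_ae (Eventually.of_forall fun x => ?_)).trans key
    exact (e x).symm
  exact e'.trans (hν t f hf.continuous).symm

end Uniqueness

/-! ### Differentiability in the parameter -/

section Expansion

variable {E : Type*} [NormedAddCommGroup E] [NormedSpace ℝ E] {α : ℝ≥0}

/-- First order expansion of the characteristics in the parameter `h`, uniform in the starting
point `y`. The coefficient `Y y` solves the linearized augmented equation with source `B₁`. -/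
theorem exists_characteristics_expansion [CompleteSpace E] (hα₁ : α ≤ 1) {B B₁ : ℝ → E → E}
    {DB DB₁ : ℝ → E → E →L[ℝ] E} {g : ℝ → E → ℝ} {Dg : ℝ → E → E →L[ℝ] ℝ}
    (hB : IsHolderFamily α B DB) (hB₁ : IsHolderFamily α B₁ DB₁) (hg : IsHolderFamily α g Dg)
    {Φ : ℝ → ℝ → E → E} {W : ℝ → ℝ → E → ℝ}
    (hc : ∀ h, IsCharacteristics (fun t x => B t x + h • B₁ t x) g (Φ h) (W h)) (h₀ t : ℝ) :
    ∃ (L C : ℝ) (Y : E → E × ℝ), 0 ≤ L ∧ 0 ≤ C ∧ ∀ h y,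
      ‖(Φ h t y, W h t y) - (Φ h₀ t y, W h₀ t y)‖ ≤ L * |h - h₀| ∧
      (|h - h₀| ≤ 1 → ‖(Φ h t y, W h t y) - (Φ h₀ t y, W h₀ t y) - (h - h₀) • Y y‖
        ≤ C * |h - h₀| ^ (1 + α : ℝ)) := by
  have hV := (hB.add (hB₁.const_smul h₀)).augmented hg
  obtain ⟨C₁, hC₁, h₁⟩ := hV.exists_norm_sub_le |t|
  obtain ⟨C₂, hC₂, h₂⟩ := hV.exists_norm_sub_sub_le |t|
  obtain ⟨K, hK, hb⟩ := hB₁.exists_bound |t|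
  have hX : ∀ y s, HasDerivAt (fun s => (Φ h₀ s y, W h₀ s y))
      (B s (Φ h₀ s y) + h₀ • B₁ s (Φ h₀ s y), g s (Φ h₀ s y)) s := fun y s =>
    ((hc h₀).flow.hasDerivAt y s).prodMk ((hc h₀).hasDerivAt_weight y s)
  have hX' : ∀ h y s, HasDerivAt (fun s => (Φ h s y, W h s y))
      ((B s (Φ h s y) + h₀ • B₁ s (Φ h s y), g s (Φ h s y))
        + (h - h₀) • (B₁ s (Φ h s y), (0 : ℝ))) s := fun h y s => by
    convert! ((hc h).flow.hasDerivAt y s).prodMk ((hc h).hasDerivAt_weight y s) using 1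
    refine Prod.ext ?_ (by simp)
    change B s (Φ h s y) + h₀ • B₁ s (Φ h s y) + (h - h₀) • B₁ s (Φ h s y)
      = B s (Φ h s y) + h • B₁ s (Φ h s y)
    rw [sub_smul]
    abel
  have hY : ∀ y, ∃ Y : ℝ → E × ℝ, Y 0 = 0 ∧ ∀ s, HasDerivAt Y
      ((((DB s (Φ h₀ s y) + h₀ • DB₁ s (Φ h₀ s y)).prod (Dg s (Φ h₀ s y))).comp
        (ContinuousLinearMap.fst ℝ E ℝ)) (Y s) + (B₁ s (Φ h₀ s y), 0)) s := fun y => by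
    have hXc : Continuous fun s => (Φ h₀ s y, W h₀ s y) :=
      continuous_iff_continuousAt.2 fun s => (hX y s).continuousAt
    have hA := hV.continuous_deriv.comp (continuous_id.prodMk hXc)
    have hr : Continuous fun s => (B₁ s (Φ h₀ s y), (0 : ℝ)) :=
      (hB₁.continuous.comp (continuous_id.prodMk (continuous_fst.comp hXc))).prodMk continuous_const
    refine exists_forall_hasDerivAt (f := fun s p =>
      ((((DB s (Φ h₀ s y) + h₀ • DB₁ s (Φ h₀ s y)).prod (Dg s (Φ h₀ s y))).comp
        (ContinuousLinearMap.fst ℝ E ℝ)) p + (B₁ s (Φ h₀ s y), 0))) (((hA.comp continuous_fst).clm_apply continuous_snd).add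
      (hr.comp continuous_fst)) (fun T => ?_) 0
    obtain ⟨K', hK', hb'⟩ := hV.exists_bound T
    refine ⟨⟨K', hK'⟩, fun s hs => LipschitzWith.of_dist_le_mul fun p q => ?_⟩
    rw [dist_add_right, dist_eq_norm, dist_eq_norm, ← map_sub]
    exact ContinuousLinearMap.le_of_opNorm_le _ (hb' s hs (Φ h₀ s y, W h₀ s y)).2.1 _
  choose Y hY0 hY using hY
  have hini : ∀ h y, (Φ h 0 y, W h 0 y) = (y, 0) := fun h y => by
    rw [(hc h).flow.zero, (hc h).weight_zero]
  have hpair : ∀ x : E, ‖(x, (0 : ℝ))‖ = ‖x‖ := fun x => by simp [Prod.norm_mk]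
  have hL : ∀ h y s, |s| ≤ |t| →
      ‖(Φ h s y, W h s y) - (Φ h₀ s y, W h₀ s y)‖ ≤ C₁ * K * |h - h₀| := fun h y s hs => by
    have := h₁ (fun s => (Φ h₀ s y, W h₀ s y)) (fun s => (Φ h s y, W h s y))
      (fun s => (h - h₀) • (B₁ s (Φ h s y), (0 : ℝ))) (|h - h₀| * K) (by positivity) (hX y) (hX' h y)
      (fun r hr => by
        rw [norm_smul, Real.norm_eq_abs, hpair]
        gcongr
        exact (hb r hr _).1) s hs
    rw [hini, hini, sub_self, norm_zero, zero_add] at this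
    linarith
  refine ⟨C₁ * K, C₂ * ((C₁ * K) ^ (1 + α : ℝ) + K * (C₁ * K)), fun y => Y y t, by positivity,
    by positivity, fun h y => ⟨hL h y t le_rfl, fun hle => ?_⟩⟩
  have := h₂ (fun s => (Φ h₀ s y, W h₀ s y)) (fun s => (Φ h s y, W h s y))
    (fun s => (h - h₀) • Y y s) (fun s => (h - h₀) • (B₁ s (Φ h₀ s y), (0 : ℝ)))
    (fun s => (h - h₀) • (B₁ s (Φ h s y), (0 : ℝ))) (C₁ * K * |h - h₀|)
    (|h - h₀| * (K * (C₁ * K * |h - h₀|))) (by positivity) (by positivity) (hX y) (hX' h y)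
    (fun s => by
      rw [map_smul, ← smul_add]
      exact (hY y s).const_smul (h - h₀)) (hL h y) (fun s hs => by
      rw [← smul_sub, norm_smul, Real.norm_eq_abs, Prod.mk_sub_mk, sub_self, hpair]
      refine mul_le_mul_of_nonneg_left ((hB₁.norm_sub_le (fun x => (hb s hs x).2.1) _ _).trans ?_)
        (abs_nonneg _)
      exact mul_le_mul_of_nonneg_left ((norm_fst_le _).trans (hL h y s hs)) hK) t le_rfl
  refine this.trans ?_
  rw [hini, hini, hY0, smul_zero, sub_self, sub_zero, norm_zero, zero_add, mul_assoc C₂]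
  refine mul_le_mul_of_nonneg_left ?_ hC₂
  rw [Real.mul_rpow (by positivity) (abs_nonneg _), add_mul]
  refine add_le_add le_rfl ?_
  have h3 : |h - h₀| * |h - h₀| ≤ |h - h₀| ^ (1 + α : ℝ) := by
    rw [← pow_two, ← Real.rpow_natCast]
    refine Real.rpow_le_rpow_of_exponent_ge' (abs_nonneg _) hle (by positivity) ?_
    have : (α : ℝ) ≤ 1 := hα₁
    push_cast
    linarith
  calc |h - h₀| * (K * (C₁ * K * |h - h₀|)) = K * (C₁ * K) * (|h - h₀| * |h - h₀|) := by ring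
    _ ≤ _ := by gcongr

/-- First order Taylor expansion of `f(x) exp(z)`. -/
theorem HolderC1.abs_mul_exp_sub_le (hα₁ : α ≤ 1) (f : HolderC1 α E ℝ) {p q : E × ℝ} {ρ : ℝ}
    (hρ : ‖q - p‖ ≤ ρ) (hρ₁ : ρ ≤ 1) :
    |f q.1 * Real.exp q.2 - f p.1 * Real.exp p.2
        - (fderiv ℝ f p.1 (q - p).1 + f p.1 * (q - p).2) * Real.exp p.2|
      ≤ 4 * Real.exp p.2 * ‖f‖ * ρ ^ (1 + α : ℝ) := by
  obtain ⟨x, z⟩ := p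
  obtain ⟨x', z'⟩ := q
  have hρ0 : 0 ≤ ρ := (norm_nonneg _).trans hρ
  have ha : ‖x' - x‖ ≤ ρ := (norm_fst_le ((x', z') - (x, z))).trans hρ
  have hz : |z' - z| ≤ ρ := (norm_snd_le ((x', z') - (x, z))).trans hρ
  have h1 : |f x' - f x - fderiv ℝ f x (x' - x)| ≤ ‖f‖ * ρ ^ (1 + α : ℝ) := by
    refine (norm_sub_sub_le_of_holder (norm_nonneg _) α.2 f.hasFDerivAt f.norm_fderiv_sub_le x
      x').trans ?_
    exact mul_le_mul_of_nonneg_left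
      (Real.rpow_le_rpow (norm_nonneg _) ha (add_nonneg zero_le_one α.2)) (norm_nonneg _)
  have h2 : |f x' - f x| ≤ ‖f‖ * ρ := by
    have := Convex.norm_image_sub_le_of_norm_hasFDerivWithin_le (f := f) (s := univ)
      (fun z _ => (f.hasFDerivAt z).hasFDerivWithinAt) (fun z _ => f.norm_fderiv_le z) convex_univ
      (mem_univ x) (mem_univ x')
    refine this.trans ?_
    gcongr
  have h3 : |Real.exp (z' - z) - 1| ≤ 2 * ρ :=
    (Real.abs_exp_sub_one_le (hz.trans hρ₁)).trans (by gcongr)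
  have h4 : |Real.exp (z' - z) - 1 - (z' - z)| ≤ ρ ^ 2 :=
    (Real.abs_exp_sub_one_sub_id_le (hz.trans hρ₁)).trans (by
      rw [← sq_abs]
      gcongr)
  have h5 : ρ ^ 2 ≤ ρ ^ (1 + α : ℝ) := by
    rw [← Real.rpow_natCast]
    refine Real.rpow_le_rpow_of_exponent_ge' hρ0 hρ₁ (by positivity) ?_
    have : (α : ℝ) ≤ 1 := hα₁
    push_cast
    linarith
  have e : f x' * Real.exp z' - f x * Real.exp z
      - (fderiv ℝ f x (x' - x) + f x * (z' - z)) * Real.exp z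
      = Real.exp z * ((f x' - f x - fderiv ℝ f x (x' - x))
        + (f x' - f x) * (Real.exp (z' - z) - 1) + f x * (Real.exp (z' - z) - 1 - (z' - z))) := by
    have : Real.exp z' = Real.exp z * Real.exp (z' - z) := by
      rw [← Real.exp_add, add_sub_cancel]
    rw [this]
    ring
  simp only [Prod.mk_sub_mk]
  rw [e, abs_mul, Real.abs_exp]
  have h6 : |f x| ≤ ‖f‖ := f.norm_apply_le x
  calc _ ≤ Real.exp z * (‖f‖ * ρ ^ (1 + α : ℝ) + ‖f‖ * ρ * (2 * ρ) + ‖f‖ * ρ ^ 2) := by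
        refine mul_le_mul_of_nonneg_left ?_ (Real.exp_pos _).le
        refine (abs_add_le _ _).trans (add_le_add ((abs_add_le _ _).trans (add_le_add h1 ?_)) ?_)
        · rw [abs_mul]
          gcongr
        · rw [abs_mul]
          gcongr
    _ = Real.exp z * ‖f‖ * (ρ ^ (1 + α : ℝ) + 3 * ρ ^ 2) := by ring
    _ ≤ Real.exp z * ‖f‖ * (4 * ρ ^ (1 + α : ℝ)) := by
        gcongr
        linarith
    _ = _ := by ring

theorem HolderC1.abs_fderiv_mul_exp_le (f : HolderC1 α E ℝ) (p q : E × ℝ) :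
    |(fderiv ℝ f p.1 q.1 + f p.1 * q.2) * Real.exp p.2| ≤ 2 * Real.exp p.2 * ‖f‖ * ‖q‖ := by
  rw [abs_mul, Real.abs_exp]
  have h1 : |fderiv ℝ f p.1 q.1| ≤ ‖f‖ * ‖q‖ :=
    ((fderiv ℝ f p.1).le_of_opNorm_le (f.norm_fderiv_le _) _).trans (by
      gcongr
      exact norm_fst_le q)
  have h2 : |f p.1 * q.2| ≤ ‖f‖ * ‖q‖ := by
    rw [abs_mul]
    exact mul_le_mul (f.norm_apply_le _) (norm_snd_le q) (abs_nonneg _) (norm_nonneg _)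
  have h3 := (abs_add_le (fderiv ℝ f p.1 q.1) (f p.1 * q.2)).trans (add_le_add h1 h2)
  nlinarith [Real.exp_pos p.2, mul_le_mul_of_nonneg_right h3 (Real.exp_pos p.2).le]

end Expansion

/-- Difference quotients that satisfy a Cauchy estimate converge, in a complete space. -/
theorem differentiableWithinAt_of_norm_slope_sub_le {F : Type*} [NormedAddCommGroup F]
    [NormedSpace ℝ F] [CompleteSpace F] {f : ℝ → F} {s : Set ℝ} {x α C r : ℝ} (hα : 0 < α)
    (hr : 0 < r) (h : ∀ y ∈ s, ∀ z ∈ s, y ≠ x → z ≠ x → |y - x| ≤ r → |z - x| ≤ r →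
      ‖slope f x y - slope f x z‖ ≤ C * (|y - x| ^ α + |z - x| ^ α)) :
    DifferentiableWithinAt ℝ f s x := by
  rcases eq_or_neBot (𝓝[s \ {x}] x) with hbot | hne
  · exact (hasDerivWithinAt_iff_tendsto_slope.2 (by rw [hbot]; exact tendsto_bot (l := 𝓝 0))
      : HasDerivWithinAt f 0 s x).differentiableWithinAt
  have hcau : Cauchy (map (slope f x) (𝓝[s \ {x}] x)) := by
    rw [Metric.cauchy_iff]
    refine ⟨inferInstance, fun ε hε => ?_⟩
    have hcont : Continuous fun y : ℝ => |C| * |y - x| ^ α :=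
      continuous_const.mul (Continuous.rpow_const (by fun_prop) fun _ => Or.inr hα.le)
    have h1 : ∀ᶠ y in 𝓝 x, |C| * |y - x| ^ α < ε / 2 :=
      hcont.continuousAt.eventually_lt continuousAt_const (by
        rw [sub_self, abs_zero, Real.zero_rpow hα.ne']
        linarith)
    have h2 : ∀ᶠ y in 𝓝 x, |y - x| < r :=
      ContinuousAt.eventually_lt (by fun_prop) continuousAt_const (by simpa using hr)
    refine ⟨_, image_mem_map (inter_mem (nhdsWithin_le_nhds (inter_mem h1 h2))
      self_mem_nhdsWithin), ?_⟩
    rintro _ ⟨y, ⟨⟨hy1, hy2⟩, hys, hyx⟩, rfl⟩ _ ⟨z, ⟨⟨hz1, hz2⟩, hzs, hzx⟩, rfl⟩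
    rw [dist_eq_norm]
    have h3 := h y hys z hzs hyx hzx (le_of_lt hy2) (le_of_lt hz2)
    have h4 : C * (|y - x| ^ α + |z - x| ^ α) ≤ |C| * (|y - x| ^ α + |z - x| ^ α) :=
      mul_le_mul_of_nonneg_right (le_abs_self C) (by positivity)
    have h5 : |C| * |y - x| ^ α < ε / 2 := hy1
    have h6 : |C| * |z - x| ^ α < ε / 2 := hz1
    linarith
  obtain ⟨f', hf'⟩ := cauchy_map_iff_exists_tendsto.1 hcau
  exact (hasDerivWithinAt_iff_tendsto_slope.2 hf').differentiableWithinAt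

section Parameter

variable {d : ℕ} {α : ℝ≥0}

/-- Difference quotients of the transported measures, tested with `f`, are up to
`C ‖f‖ |h - h₀| ^ α` the integral of the derivative of `f(x) exp(z)` in the direction `Y`. Hence
they satisfy a Cauchy estimate in the dual norm. -/
theorem differentiableWithinAt_toZ (hα₀ : 0 < α) (hα₁ : α ≤ 1)
    {B B₁ : ℝ → EuclideanSpace ℝ (Fin d) → EuclideanSpace ℝ (Fin d)}
    {DB DB₁ : ℝ → EuclideanSpace ℝ (Fin d) →
      EuclideanSpace ℝ (Fin d) →L[ℝ] EuclideanSpace ℝ (Fin d)}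
    {g : ℝ → EuclideanSpace ℝ (Fin d) → ℝ}
    {Dg : ℝ → EuclideanSpace ℝ (Fin d) → EuclideanSpace ℝ (Fin d) →L[ℝ] ℝ}
    (hB : IsHolderFamily α B DB) (hB₁ : IsHolderFamily α B₁ DB₁) (hg : IsHolderFamily α g Dg)
    {Φ : ℝ → ℝ → EuclideanSpace ℝ (Fin d) → EuclideanSpace ℝ (Fin d)}
    {W : ℝ → ℝ → EuclideanSpace ℝ (Fin d) → ℝ}
    (hc : ∀ h, IsCharacteristics (fun t x => B t x + h • B₁ t x) g (Φ h) (W h))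
    {μ₀ : ProbabilityMeasure (EuclideanSpace ℝ (Fin d))}
    {μ : ℝ → ℝ≥0 → FiniteMeasure (EuclideanSpace ℝ (Fin d))} {s : Set ℝ}
    (hμ : ∀ h ∈ s, IsTransported (Φ h) (W h) (μ₀ : Measure (EuclideanSpace ℝ (Fin d))) (μ h))
    (t : ℝ≥0) {h₀ : ℝ} (hh₀ : h₀ ∈ s) :
    DifferentiableWithinAt ℝ (fun h => toZ α (μ h t)) s h₀ := by
  obtain ⟨L, C, Y, hL, hC, hexp⟩ := exists_characteristics_expansion hα₁ hB hB₁ hg hc h₀ t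
  obtain ⟨M, hM⟩ := (hc h₀).exists_abs_weight_le hg |(t : ℝ)|
  set D : ℝ := 4 * Real.exp M * L ^ (1 + α : ℝ) + 2 * Real.exp M * C with hD
  have hD0 : 0 ≤ D := by positivity
  let T : HolderC1 α (EuclideanSpace ℝ (Fin d)) ℝ → ℝ → EuclideanSpace ℝ (Fin d) → ℝ :=
    fun f h y => f (Φ h t y) * Real.exp (W h t y)
  let T' : HolderC1 α (EuclideanSpace ℝ (Fin d)) ℝ → EuclideanSpace ℝ (Fin d) → ℝ := fun f y =>
    (fderiv ℝ f (Φ h₀ t y) (Y y).1 + f (Φ h₀ t y) * (Y y).2) * Real.exp (W h₀ t y)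
  have hTi : ∀ f h, Integrable (T f h) (μ₀ : Measure (EuclideanSpace ℝ (Fin d))) := fun f h => by
    obtain ⟨N, hN⟩ := (hc h).exists_abs_mul_exp_weight_le hg (f := fun _ x => f x)
      (fun _ => ⟨‖f‖, fun _ _ x => f.norm_apply_le x⟩) |(t : ℝ)|
    refine Integrable.of_bound (C := N) (Continuous.aestronglyMeasurable ?_)
      (Eventually.of_forall fun y => hN t le_rfl y)
    exact ((hc h).continuous_mul_exp_weight (f := fun _ x => f x)
      (f.contDiff.continuous.comp continuous_snd)).comp (continuous_const.prodMk continuous_id)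
  -- For `|h - h₀| ≤ 1 / (L + 1)` both `|h - h₀|` and the distance of the characteristics are at most
  -- `1`, as the two expansions require.
  have key : ∀ f h y, |h - h₀| ≤ 1 / (L + 1) → h ≠ h₀ →
      |(h - h₀)⁻¹ * (T f h y - T f h₀ y) - T' f y| ≤ D * ‖f‖ * |h - h₀| ^ (α : ℝ) :=
    fun f h y hh hne => by
    have hδ : 0 < |h - h₀| := abs_pos.2 (sub_ne_zero.2 hne)
    rw [le_div_iff₀ (by positivity)] at hh
    have hδ1 : |h - h₀| ≤ 1 := by nlinarith
    have hρ1 : L * |h - h₀| ≤ 1 := by nlinarith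
    obtain ⟨h1, h2⟩ := hexp h y
    have h2 := h2 hδ1
    have h3 := f.abs_mul_exp_sub_le hα₁ h1 hρ1
    have h4 := f.abs_fderiv_mul_exp_le (Φ h₀ t y, W h₀ t y)
      ((Φ h t y, W h t y) - (Φ h₀ t y, W h₀ t y) - (h - h₀) • Y y)
    have hexpM : Real.exp (W h₀ t y) ≤ Real.exp M :=
      Real.exp_le_exp.2 ((le_abs_self _).trans (hM t le_rfl y))
    have h5 : |T f h y - T f h₀ y - (h - h₀) * T' f y|
        ≤ D * ‖f‖ * |h - h₀| ^ (1 + α : ℝ) := by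
      have e : T f h y - T f h₀ y - (h - h₀) * T' f y
          = (T f h y - T f h₀ y - (fderiv ℝ f (Φ h₀ t y) (Φ h t y - Φ h₀ t y)
              + f (Φ h₀ t y) * (W h t y - W h₀ t y)) * Real.exp (W h₀ t y))
            + (fderiv ℝ f (Φ h₀ t y) (Φ h t y - Φ h₀ t y - (h - h₀) • (Y y).1)
              + f (Φ h₀ t y) * (W h t y - W h₀ t y - (h - h₀) * (Y y).2))
              * Real.exp (W h₀ t y) := by
        simp only [T', map_sub, map_smul, smul_eq_mul]
        ring
      rw [e]
      calc _ ≤ 4 * Real.exp (W h₀ t y) * ‖f‖ * (L * |h - h₀|) ^ (1 + α : ℝ)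
            + 2 * Real.exp (W h₀ t y) * ‖f‖ * (C * |h - h₀| ^ (1 + α : ℝ)) := by
            refine (abs_add_le _ _).trans (add_le_add h3 (h4.trans ?_))
            gcongr
        _ ≤ 4 * Real.exp M * ‖f‖ * (L * |h - h₀|) ^ (1 + α : ℝ)
            + 2 * Real.exp M * ‖f‖ * (C * |h - h₀| ^ (1 + α : ℝ)) := by gcongr
        _ = _ := by
            rw [Real.mul_rpow hL hδ.le, hD]
            ring
    have h6 : (h - h₀)⁻¹ * (T f h y - T f h₀ y) - T' f y
        = (h - h₀)⁻¹ * (T f h y - T f h₀ y - (h - h₀) * T' f y) := by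
      have := sub_ne_zero.2 hne
      field_simp
    rw [h6, abs_mul, abs_inv, inv_mul_le_iff₀ hδ]
    refine h5.trans (le_of_eq ?_)
    rw [Real.rpow_add hδ, Real.rpow_one]
    ring
  have : CompleteSpace (Z α d) :=
    (measureSubspace α d).isClosed_topologicalClosure.completeSpace_coe
  refine differentiableWithinAt_of_norm_slope_sub_le (F := Z α d) (C := D) (r := 1 / (L + 1))
    (NNReal.coe_pos.2 hα₀) (by positivity) fun h hh k hk hne kne hle kle => ?_
  rw [← Submodule.norm_coe]
  refine ContinuousLinearMap.opNorm_le_bound _ (by positivity) fun f => ?_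
  have hval : ∀ h ∈ s, measureFunctional α (μ h t) f
      = ∫ y, T f h y ∂(μ₀ : Measure (EuclideanSpace ℝ (Fin d))) := fun h hh =>
    hμ h hh t f f.contDiff.continuous
  have hslope : ∀ h ∈ s, ((slope (fun h => toZ α (μ h t)) h₀ h : Z α d) : StrongDual ℝ _) f
      = ∫ y, (h - h₀)⁻¹ * (T f h y - T f h₀ y) ∂(μ₀ : Measure (EuclideanSpace ℝ (Fin d))) :=
    fun h hh => by
    rw [integral_const_mul, integral_sub (hTi f h) (hTi f h₀), ← hval h hh, ← hval h₀ hh₀]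
    rfl
  have hsi : ∀ h, Integrable (fun y => (h - h₀)⁻¹ * (T f h y - T f h₀ y))
      (μ₀ : Measure (EuclideanSpace ℝ (Fin d))) := fun h =>
    ((hTi f h).sub (hTi f h₀)).const_mul _
  have e : ((slope (fun h => toZ α (μ h t)) h₀ h - slope (fun h => toZ α (μ h t)) h₀ k : Z α d) :
      StrongDual ℝ _) f = ∫ y, ((h - h₀)⁻¹ * (T f h y - T f h₀ y)
        - (k - h₀)⁻¹ * (T f k y - T f h₀ y)) ∂(μ₀ : Measure (EuclideanSpace ℝ (Fin d))) := by
    rw [integral_sub (hsi h) (hsi k), ← hslope h hh, ← hslope k hk]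
    rfl
  rw [e]
  refine (norm_integral_le_of_norm_le_const (Eventually.of_forall fun y => ?_)).trans_eq
    (by rw [probReal_univ, mul_one])
  have h1 := key f h y hle hne
  have h2 := key f k y kle kne
  rw [abs_sub_comm] at h2
  refine (norm_sub_le_norm_sub_add_norm_sub _ (T' f y) _).trans ((add_le_add h1 h2).trans_eq ?_)
  ring

end Parameter

end MeasureTransport

theorem theorem1 (d : ℕ) (α : ℝ≥0) (hα₀ : 0 < α) (hα₁ : α ≤ 1)
    (b b₁ : ℝ≥0 → MeasureTransport.HolderC1 α (EuclideanSpace ℝ (Fin d)) (EuclideanSpace ℝ (Fin d)))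
    (hb : Continuous b) (hb₁ : Continuous b₁)
    (w : ℝ × EuclideanSpace ℝ (Fin d) → ℝ)
    (hw : MeasureTransport.MemHolderC1On α w (Ici (0 : ℝ) ×ˢ (univ : Set (EuclideanSpace ℝ (Fin d)))))
    (μ₀ : ProbabilityMeasure (EuclideanSpace ℝ (Fin d))) :
    (∀ h ∈ Icc (-1 / 2 : ℝ) (1 / 2), ∃! μ : ℝ≥0 → FiniteMeasure (EuclideanSpace ℝ (Fin d)),
      MeasureTransport.IsWeakSolution (fun t x => b t x + h • b₁ t x) w μ₀ μ) ∧
    ∀ μ : ℝ → ℝ≥0 → FiniteMeasure (EuclideanSpace ℝ (Fin d)),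
      (∀ h ∈ Icc (-1 / 2 : ℝ) (1 / 2),
        MeasureTransport.IsWeakSolution (fun t x => b t x + h • b₁ t x) w μ₀ (μ h)) →
      ∀ t : ℝ≥0,
        DifferentiableOn ℝ (fun h : ℝ => MeasureTransport.toZ α (μ h t)) (Icc (-1 / 2 : ℝ) (1 / 2)) := by
  have hB := MeasureTransport.isHolderFamily_of_continuous hb
  have hB₁ := MeasureTransport.isHolderFamily_of_continuous hb₁
  have hg := MeasureTransport.isHolderFamily_of_memHolderC1On hα₀ hw
  have hv := fun h : ℝ => hB.add (hB₁.const_smul h)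
  choose Φ W hc using fun h => MeasureTransport.exists_isCharacteristics hα₀ (hv h) hg
  choose ν hν using fun h =>
    (hc h).exists_isTransported hg (μ₀ : Measure (EuclideanSpace ℝ (Fin d)))
  have huniq : ∀ h μ,
      MeasureTransport.IsWeakSolution (fun t x => b t x + h • b₁ t x) w μ₀ μ → μ = ν h :=
    fun h μ hμ => hμ.eq_of_isTransported hα₀ (hv h) hg (hc h) (hν h)
  refine ⟨fun h _ => ⟨ν h, (hν h).isWeakSolution (hv h) hg (hc h), huniq h⟩,
    fun μ hμ t h₀ hh₀ => ?_⟩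
  refine MeasureTransport.differentiableWithinAt_toZ hα₀ hα₁ hB hB₁ hg hc (μ₀ := μ₀) (fun h hh => ?_) t hh₀
  rw [huniq h (μ h) (hμ h hh)]
  exact hν h
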